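/- **Conventions.** A *stable abelian category* is an abelian category with an additive suspension autoequivalence $\Sigma$. Let $\mathfrak T$ be a triangulated category. A *stable homological functor* $F\colon\mathfrak T\to\mathfrak C$ is a functor to a stable abelian category such that $F(A)\to F(B)\to F(C)$ is exact for every exact triangle $A\to B\to C\to\Sigma A$, together with a natural isomorphism $F(\Sigma A)\cong\Sigma F(A)$; a *stable exact functor* between stable abelian categories is an exact functor with such a natural isomorphism. An *ideal* $\mathfrak I$ in $\mathfrak T$ is a family of subgroups $\mathfrak I(A,B)\subseteq\mathfrak T(A,B)$ closed under composition with arbitrary morphisms on both sides; it is *homological* if $\mathfrak I=\ker G:=\{f\mid G(f)=0\}$ for some stable homological functor $G$. A functor $G$ is *$\mathfrak I$-exact* if $G(f)=0$ for all $f\in\mathfrak I$. An $\mathfrak I$-exact stable homological functor $F\colon\mathfrak T\to\mathfrak C$ is *universal* if every $\mathfrak I$-exact stable homological functor $G\colon\mathfrak T\to\mathfrak C'$ factors as $G\cong\bar G\circ F$ (as stable functors) for a stable exact functor $\bar G\colon\mathfrak C\to\mathfrak C'$ that is unique up to natural isomorphism (of stable functors, compatible with the factorizations). An object $P$ of $\mathfrak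 T$ is *$\mathfrak I$-projective* if the functor $\mathfrak T(P,-)$ is $\mathfrak I$-exact; a morphism $f\colon A\to B$ is *$\mathfrak I$-epic* if $g\in\mathfrak I$ in an exact triangle $A\xrightarrow{f}B\xrightarrow{g}C\to\Sigma A$; *there are enough $\mathfrak I$-projective objects* if every object $A$ of $\mathfrak T$ admits an $\mathfrak I$-epic morphism $P\to A$ with $P$ $\mathfrak I$-projective. The *partial left adjoint* $F^\vdash$ of $F$ is defined on the full subcategory of those objects $A$ of $\mathfrak C$ for which the functor $B\mapsto\mathfrak C(A,F(B))$ on $\mathfrak T$ is corepresentable; $F^\vdash(A)$ is the corepresenting object, so that $\mathfrak T(F^\vdash(A),B)\cong\mathfrak C(A,F(B))$ naturally in $B$. **Theorem.** Let $\mathfrak T$ be a triangulated category in which idempotent morphisms split, let $\mathfrak I$ be a homological ideal in $\mathfrak T$, and let $F\colon\mathfrak T\to\mathfrak C$ be an $\mathfrak I$-exact stable homological functor into a stable abelian category $\mathfrak C$; let $\mathfrak{PC}$ be the full subcategory of projective objects of $\mathfrak C$. Then $F$ is the universal $\mathfrak I$-exact stable homological functor and there are enough $\mathfrak I$-projective objects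 in $\mathfrak T$ if and only if $\ker F=\mathfrak I$ and the following three conditions hold: * $\mathfrak C$ has enough projective objects; * the partial left adjoint $F^\vdash$ is defined on $\mathfrak{PC}$; * $F\circ F^\vdash(A)\cong A$ naturally in $A\in\mathfrak{PC}$, that is, the functor $F\circ F^\vdash|_{\mathfrak{PC}}$ is naturally isomorphic to the inclusion $\mathfrak{PC}\to\mathfrak C$. -/

import Mathlib

open CategoryTheory Limits Pretriangulated

universe w z u v u' v' u'' v''

/-- A stable additive category: an additive category with an additive suspension, given as an
autoequivalence. -/
class StableCategory (C : Type u) [Category.{v} C] [Preadditive C] where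
  /-- the suspension autoequivalence -/
  suspEquiv : C ≌ C
  additive : suspEquiv.functor.Additive

/-- The suspension functor `Σ` of a stable additive category. -/
abbrev susp (C : Type u) [Category.{v} C] [Preadditive C] [StableCategory C] : C ⥤ C :=
  (StableCategory.suspEquiv (C := C)).functor

/-- The suspension of a triangulated category is its shift by `1`. -/
noncomputable instance StableCategory.ofShift (T : Type u) [Category.{v} T] [Preadditive T]
    [HasShift T ℤ] [∀ n : ℤ, (shiftFunctor T n).Additive] : StableCategory T where
  suspEquiv := shiftEquiv T (1 : ℤ)
  additive := inferInstanceAs (shiftFunctor T (1 : ℤ)).Additive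

/-- A stable homological functor `T ⥤ C`: a homological functor together with a natural
isomorphism `F (Σ A) ≅ Σ (F A)`. -/
structure StableHomologicalFunctor (T : Type u) [Category.{v} T] [Preadditive T]
    [HasZeroObject T] [HasShift T ℤ] [∀ n : ℤ, (shiftFunctor T n).Additive] [Pretriangulated T]
    (C : Type u') [Category.{v'} C] [Abelian C] [StableCategory C] where
  functor : T ⥤ C
  isHomological : functor.IsHomological
  suspIso : susp T ⋙ functor ≅ functor ⋙ susp C

/-- A stable exact functor between stable abelian categories: an exact functor together with a
natural isomorphism `F (Σ X) ≅ Σ (F X)`. -/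
structure StableExactFunctor (C : Type u) [Category.{v} C] [Abelian C] [StableCategory C]
    (D : Type u') [Category.{v'} D] [Abelian D] [StableCategory D] where
  functor : C ⥤ D
  preservesFiniteLimits : PreservesFiniteLimits functor
  preservesFiniteColimits : PreservesFiniteColimits functor
  suspIso : susp C ⋙ functor ≅ functor ⋙ susp D

/-- An ideal in a preadditive category: a family of subgroups of the morphism groups that is closed
under composition with arbitrary morphisms on both sides. -/
@[ext]
structure MorphismIdeal (T : Type u) [Category.{v} T] [Preadditive T] where
  hom (A B : T) : AddSubgroup (A ⟶ B)
  comp_mem {A B B' D : T} (f : A ⟶ B) (g : B ⟶ B') (h : B' ⟶ D) :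
    g ∈ hom B B' → f ≫ g ≫ h ∈ hom A D

namespace MorphismIdeal

section Additive

variable {T : Type u} [Category.{v} T] [Preadditive T]

/-- The kernel of an additive functor: the ideal of all morphisms `f` with `F f = 0`. -/
def ker {C : Type u'} [Category.{v'} C] [Preadditive C] (F : T ⥤ C) [F.Additive] :
    MorphismIdeal T where
  hom A B := (F.mapAddHom (X := A) (Y := B)).ker
  comp_mem f g h hg := by
    have hg' : F.map g = 0 := hg
    change F.map (f ≫ g ≫ h) = 0
    simp [hg']

/-- A functor is `I`-exact if it vanishes on the morphisms in `I`. -/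
def IsExact (I : MorphismIdeal T) {C : Type u'} [Category.{v'} C] [Preadditive C]
    (F : T ⥤ C) : Prop :=
  ∀ ⦃A B : T⦄ (f : A ⟶ B), f ∈ I.hom A B → F.map f = 0

/-- An object `A` is `I`-projective if the functor `T(A, -)` to abelian groups is `I`-exact. -/
def IsProjective (I : MorphismIdeal T) (A : T) : Prop :=
  I.IsExact (preadditiveCoyoneda.obj (Opposite.op A))

end Additive

variable {T : Type u} [Category.{v} T] [Preadditive T]
  [HasZeroObject T] [HasShift T ℤ] [∀ n : ℤ, (shiftFunctor T n).Additive] [Pretriangulated T]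

/-- The kernel of a stable homological functor. -/
def kerStable {C : Type u'} [Category.{v'} C] [Abelian C] [StableCategory C]
    (F : StableHomologicalFunctor T C) : MorphismIdeal T :=
  haveI := F.isHomological
  ker F.functor

/-- An ideal is homological if it is the kernel of a stable homological functor to a stable
abelian category. -/
def IsHomological (I : MorphismIdeal.{u, v} T) : Prop :=
  ∃ (D : Type u'') (_ : Category.{v''} D) (_ : Abelian D) (_ : StableCategory D)
    (G : StableHomologicalFunctor T D), kerStable G = I

/-- A morphism `f : A ⟶ B` is `I`-epic if `g ∈ I` in an exact triangle
`A ⟶ B ⟶ X ⟶ Σ A` with maps `f`, `g`, `h` (the triangle is unique up to isomorphism). -/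
def IsEpic (I : MorphismIdeal T) {A B : T} (f : A ⟶ B) : Prop :=
  ∃ (X : T) (g : B ⟶ X) (h : X ⟶ A⟦(1 : ℤ)⟧),
    Triangle.mk f g h ∈ distTriang T ∧ g ∈ I.hom B X

/-- There are enough `I`-projective objects: each object `A` admits an `I`-epic morphism `P ⟶ A`
from an `I`-projective object `P`. -/
def HasEnoughProjectives (I : MorphismIdeal T) : Prop :=
  ∀ A : T, ∃ (P : T) (π : P ⟶ A), I.IsProjective P ∧ I.IsEpic π

end MorphismIdeal

section Universal

variable {T : Type u} [Category.{v} T] [Preadditive T]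
  [HasZeroObject T] [HasShift T ℤ] [∀ n : ℤ, (shiftFunctor T n).Additive] [Pretriangulated T]
  {C : Type u'} [Category.{v'} C] [Abelian C] [StableCategory C]

/-- A factorization `G ≅ Ḡ ∘ F` of a stable homological functor `G` through a stable
homological functor `F`, where `Ḡ` is a stable exact functor; the isomorphism is one of stable
functors, that is, it is compatible with the suspension isomorphisms. -/
structure StableFactorization (F : StableHomologicalFunctor T C)
    {D : Type u''} [Category.{v''} D] [Abelian D] [StableCategory D]
    (G : StableHomologicalFunctor T D) where
  lift : StableExactFunctor C D
  iso : F.functor ⋙ lift.functor ≅ G.functor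
  iso_susp (A : T) :
    iso.hom.app ((susp T).obj A) ≫ G.suspIso.hom.app A =
      lift.functor.map (F.suspIso.hom.app A) ≫ lift.suspIso.hom.app (F.functor.obj A) ≫
        (susp D).map (iso.hom.app A)

/-- `F` is a universal `I`-exact stable homological functor: it is `I`-exact, and every `I`-exact
stable homological functor `G` to a stable abelian category (with objects in `Type w` and
morphisms in `Type z`) factors as `G ≅ Ḡ ∘ F` for a stable exact functor `Ḡ`, which is unique up
to a natural isomorphism (of stable functors, compatible with the factorizations). -/
structure IsUniversalExact (I : MorphismIdeal T) (F : StableHomologicalFunctor T C) : Prop where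
  isExact : I.IsExact F.functor
  exists_factorization (D : Type w) [Category.{z} D] [Abelian D] [StableCategory D]
    (G : StableHomologicalFunctor T D) (hG : I.IsExact G.functor) :
    Nonempty (StableFactorization F G)
  unique (D : Type w) [Category.{z} D] [Abelian D] [StableCategory D]
    (G : StableHomologicalFunctor T D) (hG : I.IsExact G.functor)
    (Φ Ψ : StableFactorization F G) :
    ∃ θ : Φ.lift.functor ≅ Ψ.lift.functor,
      (∀ A : T, θ.hom.app (F.functor.obj A) ≫ Ψ.iso.hom.app A = Φ.iso.hom.app A) ∧
      (∀ X : C, θ.hom.app ((susp C).obj X) ≫ Ψ.lift.suspIso.hom.app X =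
        Φ.lift.suspIso.hom.app X ≫ (susp D).map (θ.hom.app X))

end Universal

/-!
An object `Q` of `T` such that `F Q` is projective and `F` is bijective on morphisms out of `Q`
plays the role of a free object. The conditions on `F` and the partial left adjoint say that every
projective object of `C` is of the form `F Q` for such a `Q`, and then every object `X` of `C` has
a presentation `F Q₁ ⟶ F Q₀ ⟶ X ⟶ 0`. An exact functor is determined by its composition with `F`
through such presentations: it is a left Kan extension along `F`. Conversely, if a homological
functor `G` vanishes on `ker F`, its left Kan extension along `F` is exact and restricts to `G`.
Hence `F` is universal for the ideal `ker F`.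

If an ideal `I` has enough projective objects, then the functors on them that are coherent, in the
sense of Freyd, form an abelian category, and the restricted Yoneda functor to it has kernel `I`
and enough projective lifts `Q`. By the above it is universal, so every universal functor agrees
with it up to an equivalence. As idempotents split in `T`, retracts of projective objects `F Q` are
of this form again, so that all projective objects lift.
-/

/-! ### Lifts of projective objects -/

section ProjectiveLifts

variable {T : Type u} [Category.{v} T] {C : Type u'} [Category.{v'} C]

/-- `Q` is a lift along `F` of a projective object: `F Q` is projective, and `F` is bijective on
morphisms out of `Q`, so that `Q` is the value at `F Q` of the partial left adjoint of `F`. -/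
structure IsProjectiveLift (F : T ⥤ C) (Q : T) : Prop where
  projective : Projective (F.obj Q)
  bijective (B : T) : Function.Bijective (F.map : (Q ⟶ B) → (F.obj Q ⟶ F.obj B))

/-- `F` has enough projective lifts: every object of the target is a quotient of `F Q` for a
projective lift `Q`. -/
def HasEnoughProjectiveLifts (F : T ⥤ C) : Prop :=
  ∀ X : C, ∃ (Q : T) (p : F.obj Q ⟶ X), IsProjectiveLift F Q ∧ Epi p

variable {F : T ⥤ C}

namespace IsProjectiveLift

variable {Q : T}

lemma map_injective (hQ : IsProjectiveLift F Q) {B : T} :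
    Function.Injective (F.map : (Q ⟶ B) → (F.obj Q ⟶ F.obj B)) :=
  (hQ.bijective B).1

lemma map_surjective (hQ : IsProjectiveLift F Q) {B : T} :
    Function.Surjective (F.map : (Q ⟶ B) → (F.obj Q ⟶ F.obj B)) :=
  (hQ.bijective B).2

lemma exists_map_comp_eq (hQ : IsProjectiveLift F Q) {A : T} {X : C} (p : F.obj A ⟶ X) [Epi p]
    (x : F.obj Q ⟶ X) : ∃ y : Q ⟶ A, F.map y ≫ p = x := by
  have := hQ.projective
  obtain ⟨y, hy⟩ := hQ.map_surjective (Projective.factorThru x p)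
  exact ⟨y, by rw [hy, Projective.factorThru_comp]⟩

lemma exists_comp_eq (hQ : IsProjectiveLift F Q) {A B : T} (f : A ⟶ B) [Epi (F.map f)]
    (y : Q ⟶ B) : ∃ x : Q ⟶ A, x ≫ f = y := by
  obtain ⟨x, hx⟩ := hQ.exists_map_comp_eq (F.map f) (F.map y)
  exact ⟨x, hQ.map_injective (by rw [F.map_comp, hx])⟩

lemma exists_comp_eq_of_exact [Abelian C] (hQ : IsProjectiveLift F Q) {A B : T} {f : A ⟶ B}
    {Z : C} {g : F.obj B ⟶ Z} {w : F.map f ≫ g = 0} (h : (ShortComplex.mk _ _ w).Exact)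
    (y : Q ⟶ B) (hy : F.map y ≫ g = 0) : ∃ x : Q ⟶ A, x ≫ f = y := by
  have := hQ.projective
  obtain ⟨x, hx⟩ := hQ.map_surjective (h.liftFromProjective (F.map y) hy)
  exact ⟨x, hQ.map_injective (by
    rw [F.map_comp, hx]
    exact h.liftFromProjective_comp _ _)⟩

end IsProjectiveLift

/-- A presentation of `X` by objects and a morphism that lift along `F`, that is, an exact sequence
`F Q₁ ⟶ F Q₀ ⟶ X ⟶ 0` induced by a morphism `Q₁ ⟶ Q₀` whose target is a projective lift. -/
structure LiftedPresentation [Abelian C] (F : T ⥤ C) (X : C) where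
  Q₁ : T
  Q₀ : T
  a : Q₁ ⟶ Q₀
  p : F.obj Q₀ ⟶ X
  isProjectiveLift : IsProjectiveLift F Q₀
  epi : Epi p
  zero : F.map a ≫ p = 0
  exact : (ShortComplex.mk _ _ zero).Exact

attribute [instance] LiftedPresentation.epi

namespace HasEnoughProjectiveLifts

lemma exists_epi_map (hF : HasEnoughProjectiveLifts F) (A : T) :
    ∃ (Q : T) (t : Q ⟶ A), IsProjectiveLift F Q ∧ Epi (F.map t) := by
  obtain ⟨Q, q, hQ, hq⟩ := hF (F.obj A)
  obtain ⟨t, rfl⟩ := hQ.map_surjective q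
  exact ⟨Q, t, hQ, hq⟩

variable [Abelian C]

lemma exists_exact (hF : HasEnoughProjectiveLifts F) {B : T} {Z : C} (g : F.obj B ⟶ Z) :
    ∃ (Q : T) (b : Q ⟶ B) (_ : IsProjectiveLift F Q) (w : F.map b ≫ g = 0),
      (ShortComplex.mk _ _ w).Exact := by
  obtain ⟨Q, q, hQ, hq⟩ := hF (kernel g)
  obtain ⟨b, hb⟩ := hQ.map_surjective (q ≫ kernel.ι g)
  have w : F.map b ≫ g = 0 := by rw [hb, Category.assoc, kernel.condition, comp_zero]
  refine ⟨Q, b, hQ, w, (ShortComplex.exact_iff_exact_up_to_refinements _).2 fun R x hx ↦ ?_⟩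
  obtain ⟨R', π, hπ, y, hy⟩ := surjective_up_to_refinements_of_epi q (kernel.lift g x hx)
  refine ⟨R', π, hπ, y, ?_⟩
  rw [← kernel.lift_ι g x hx, reassoc_of% hy, ← hb]

lemma nonempty_liftedPresentation (hF : HasEnoughProjectiveLifts F) (X : C) :
    Nonempty (LiftedPresentation F X) := by
  obtain ⟨Q₀, p, h₀, hp⟩ := hF X
  obtain ⟨Q₁, a, -, w, hw⟩ := hF.exists_exact p
  exact ⟨⟨Q₁, Q₀, a, p, h₀, hp, w, hw⟩⟩

end HasEnoughProjectiveLifts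

end ProjectiveLifts

section Transfer

variable {T : Type u} [Category.{v} T] {C : Type u'} [Category.{v'} C] {F : T ⥤ C}

lemma IsProjectiveLift.of_iso {F' : T ⥤ C} (e : F ≅ F') {Q : T} (hQ : IsProjectiveLift F Q) :
    IsProjectiveLift F' Q where
  projective := Projective.of_iso (e.app Q) hQ.projective
  bijective B := by
    refine ⟨fun f g h ↦ hQ.map_injective ?_, fun φ ↦ ?_⟩
    · rw [← NatIso.naturality_2 e f, h, NatIso.naturality_2 e g]
    · obtain ⟨f, hf⟩ := hQ.map_surjective (e.hom.app Q ≫ φ ≫ e.inv.app B)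
      exact ⟨f, by rw [← NatIso.naturality_1 e f, hf]; simp⟩

lemma IsProjectiveLift.comp_isEquivalence {D : Type u''} [Category.{v''} D] (Φ : C ⥤ D)
    [Φ.IsEquivalence] {Q : T} (hQ : IsProjectiveLift F Q) : IsProjectiveLift (F ⋙ Φ) Q where
  projective := (Φ.asEquivalence.map_projective_iff _).2 hQ.projective
  bijective B :=
    (show Function.Bijective (Φ.map : (F.obj Q ⟶ F.obj B) → _) from
      ⟨Φ.map_injective, Φ.map_surjective⟩).comp (hQ.bijective B)

lemma IsProjectiveLift.of_retract {Q Q' : T} (hQ : IsProjectiveLift F Q) (r : Retract Q' Q) :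
    IsProjectiveLift F Q' where
  projective := by
    have := hQ.projective
    exact (r.map F).projective
  bijective B := by
    refine ⟨fun f g h ↦ ?_, fun φ ↦ ?_⟩
    · have hr : r.r ≫ f = r.r ≫ g := hQ.map_injective (by rw [F.map_comp, h, F.map_comp])
      simpa using r.i ≫= hr
    · obtain ⟨f, hf⟩ := hQ.map_surjective (F.map r.r ≫ φ)
      exact ⟨r.i ≫ f, by rw [F.map_comp, hf, ← F.map_comp_assoc, r.retract]; simp⟩

/-- The idempotent `r.r ≫ r.i` of `F Q` lifts to `Q`, and `F` maps its splitting to `P`. -/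
lemma IsProjectiveLift.exists_of_retract [IsIdempotentComplete T] {Q : T}
    (hQ : IsProjectiveLift F Q) {P : C} (r : Retract P (F.obj Q)) :
    ∃ Q' : T, IsProjectiveLift F Q' ∧ Nonempty (F.obj Q' ≅ P) := by
  obtain ⟨e, he⟩ := hQ.map_surjective (r.r ≫ r.i)
  have idempotent : e ≫ e = e := hQ.map_injective (by simp [he])
  obtain ⟨Q', i, q, hiq, hqi⟩ := IsIdempotentComplete.idempotents_split Q e idempotent
  have map_iq : F.map i ≫ F.map q = 𝟙 _ := by rw [← F.map_comp, hiq, F.map_id]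
  have map_qi : F.map q ≫ F.map i = r.r ≫ r.i := by rw [← F.map_comp, hqi, he]
  refine ⟨Q', hQ.of_retract ⟨i, q, hiq⟩, ⟨⟨F.map i ≫ r.r, r.i ≫ F.map q, ?_, ?_⟩⟩⟩
  · rw [Category.assoc, ← reassoc_of% map_qi, reassoc_of% map_iq, map_iq]
  · rw [Category.assoc, reassoc_of% map_qi, r.retract, Category.comp_id, r.retract]

namespace HasEnoughProjectiveLifts

lemma of_iso {F' : T ⥤ C} (e : F ≅ F') (hF : HasEnoughProjectiveLifts F) :
    HasEnoughProjectiveLifts F' := fun X ↦ by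
  obtain ⟨Q, p, hQ, hp⟩ := hF X
  exact ⟨Q, e.inv.app Q ≫ p, hQ.of_iso e, inferInstance⟩

lemma comp_isEquivalence {D : Type u''} [Category.{v''} D] (Φ : C ⥤ D)
    [Φ.IsEquivalence] (hF : HasEnoughProjectiveLifts F) :
    HasEnoughProjectiveLifts (F ⋙ Φ) := fun X ↦ by
  obtain ⟨Q, p, hQ, hp⟩ := hF (Φ.objPreimage X)
  exact ⟨Q, Φ.map p ≫ (Φ.objObjPreimageIso X).hom, hQ.comp_isEquivalence Φ, inferInstance⟩

lemma enoughProjectives (hF : HasEnoughProjectiveLifts F) : EnoughProjectives C where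
  presentation X := by
    obtain ⟨Q, p, hQ, hp⟩ := hF X
    exact ⟨{ p := F.obj Q, projective := hQ.projective, f := p, epi := hp }⟩

end HasEnoughProjectiveLifts

variable (F) in
/-- Every projective object is of the form `F Q` for a projective lift `Q`; in other words, the
partial left adjoint of `F` is defined on projective objects and is there a section of `F`. -/
def ProjectivesLift : Prop :=
  ∀ (P : C) [Projective P], ∃ Q : T, IsProjectiveLift F Q ∧ Nonempty (F.obj Q ≅ P)

lemma ProjectivesLift.hasEnoughProjectiveLifts [EnoughProjectives C] (h : ProjectivesLift F) :
    HasEnoughProjectiveLifts F := fun X ↦ by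
  obtain ⟨Q, hQ, ⟨e⟩⟩ := h (Projective.over X)
  exact ⟨Q, e.hom ≫ Projective.π X, hQ, inferInstance⟩

lemma HasEnoughProjectiveLifts.projectivesLift [IsIdempotentComplete T]
    (hF : HasEnoughProjectiveLifts F) : ProjectivesLift F := fun P hP ↦ by
  obtain ⟨Q, p, hQ, hp⟩ := hF P
  exact hQ.exists_of_retract ⟨Projective.factorThru (𝟙 P) p, p, Projective.factorThru_comp _ _⟩

end Transfer

/-! ### Left Kan extensions along a functor with enough projective lifts -/

section KanExtension

variable {T : Type u} [Category.{v} T] {C : Type u'} [Category.{v'} C] {F : T ⥤ C}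
  {D : Type u''} [Category.{v''} D] {G : T ⥤ D}

/-- The component at `x : F A ⟶ X` of a cocone over the diagram whose colimit is the value at `X`
of the left Kan extension of `G` along `F`. -/
def kanLeg {X : C} (c : Cocone (CostructuredArrow.proj F X ⋙ G)) {A : T} (x : F.obj A ⟶ X) :
    G.obj A ⟶ c.pt :=
  c.ι.app (.mk x)

lemma map_comp_kanLeg {X : C} (c : Cocone (CostructuredArrow.proj F X ⋙ G)) {A B : T} (t : A ⟶ B)
    (x : F.obj B ⟶ X) : G.map t ≫ kanLeg c x = kanLeg c (F.map t ≫ x) :=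
  c.w (CostructuredArrow.homMk t : CostructuredArrow.mk (F.map t ≫ x) ⟶ .mk x)

lemma kanLeg_zero [HasZeroMorphisms T] [HasZeroMorphisms C] [HasZeroMorphisms D]
    [G.PreservesZeroMorphisms] {X : C} (c : Cocone (CostructuredArrow.proj F X ⋙ G)) (A : T) :
    kanLeg c (0 : F.obj A ⟶ X) = 0 := by
  have h := map_comp_kanLeg c (0 : A ⟶ A) (0 : F.obj A ⟶ X)
  rwa [G.map_zero, zero_comp, comp_zero, eq_comm] at h

section Unit

variable {E : C ⥤ D} (η : G ⟶ F ⋙ E)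

lemma map_comp_unit_comp_map {A B : T} (t : A ⟶ B) {X : C} (x : F.obj B ⟶ X) :
    G.map t ≫ η.app B ≫ E.map x = η.app A ≫ E.map (F.map t ≫ x) := by
  simp

lemma unit_comp_map_zero [HasZeroMorphisms T] [HasZeroMorphisms C] [HasZeroMorphisms D]
    [G.PreservesZeroMorphisms] (A : T) (X : C) : η.app A ≫ E.map (0 : F.obj A ⟶ X) = 0 :=
  kanLeg_zero ((Functor.LeftExtension.mk E η).coconeAt X) A

end Unit

variable [Abelian C] [Abelian D]

lemma LiftedPresentation.map_comp_eq_zero {X : C} (P : LiftedPresentation F X) {W : D}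
    {π : G.obj P.Q₀ ⟶ W} (hπ : G.map P.a ≫ π = 0) {Q : T} (hQ : IsProjectiveLift F Q)
    (y : Q ⟶ P.Q₀) (hy : F.map y ≫ P.p = 0) : G.map y ≫ π = 0 := by
  obtain ⟨x, rfl⟩ := hQ.exists_comp_eq_of_exact P.exact y hy
  rw [G.map_comp, Category.assoc, hπ, comp_zero]

section Cocone

variable [HasZeroMorphisms T] [G.PreservesZeroMorphisms]

lemma LiftedPresentation.map_comp_kanLeg {X : C} (P : LiftedPresentation F X)
    (c : Cocone (CostructuredArrow.proj F X ⋙ G)) : G.map P.a ≫ kanLeg c P.p = 0 := by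
  rw [_root_.map_comp_kanLeg, P.zero, kanLeg_zero]

lemma HasEnoughProjectiveLifts.nonempty_isColimit (hF : HasEnoughProjectiveLifts F)
    (hG : ∀ ⦃A B : T⦄ (t : A ⟶ B), Epi (F.map t) → Epi (G.map t)) {X : C}
    (P : LiftedPresentation F X) (c : Cocone (CostructuredArrow.proj F X ⋙ G)) [Epi (kanLeg c P.p)]
    (hc : (ShortComplex.mk _ _ (P.map_comp_kanLeg c)).Exact) : Nonempty (IsColimit c) := by
  have : Epi (ShortComplex.mk _ _ (P.map_comp_kanLeg c)).g := ‹_›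
  let d (s : Cocone (CostructuredArrow.proj F X ⋙ G)) : c.pt ⟶ s.pt :=
    hc.desc _ (P.map_comp_kanLeg s)
  have hd (s) : kanLeg c P.p ≫ d s = kanLeg s P.p := hc.g_desc _ (P.map_comp_kanLeg s)
  have fac (s) {A : T} (x : F.obj A ⟶ X) : kanLeg c x ≫ d s = kanLeg s x := by
    obtain ⟨Q, t, hQ, ht⟩ := hF.exists_epi_map A
    obtain ⟨y, hy⟩ := hQ.exists_map_comp_eq P.p (F.map t ≫ x)
    have := hG t ht
    rw [← cancel_epi (G.map t), map_comp_kanLeg s, ← hy, ← map_comp_kanLeg s, ← hd,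
      ← Category.assoc, ← Category.assoc, map_comp_kanLeg c, map_comp_kanLeg c, hy]
  exact ⟨{
    desc := d
    fac := fun s x ↦ fac s x.hom
    uniq := fun s m hm ↦ (cancel_epi (kanLeg c P.p)).1 ((hm _).trans (hd s).symm) }⟩

/-- Right exact functors preserve presentations, hence are determined by their restriction along
`F`. -/
lemma HasEnoughProjectiveLifts.isLeftKanExtension (hF : HasEnoughProjectiveLifts F)
    [F.PreservesZeroMorphisms] (H : C ⥤ D) [H.PreservesZeroMorphisms] [PreservesFiniteColimits H] :
    H.IsLeftKanExtension (𝟙 (F ⋙ H)) := by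
  let E := Functor.LeftExtension.mk H (𝟙 (F ⋙ H))
  have kanLeg_eq (X : C) {A : T} (x : F.obj A ⟶ X) : kanLeg (E.coconeAt X) x = H.map x :=
    Category.id_comp _
  suffices h : ∀ X, Nonempty (IsColimit (E.coconeAt X)) from
    Functor.LeftExtension.IsPointwiseLeftKanExtension.isLeftKanExtension (E := E)
      fun X ↦ (h X).some
  intro X
  obtain ⟨P⟩ := hF.nonempty_liftedPresentation X
  have : Epi (kanLeg (E.coconeAt X) P.p) := by
    rw [kanLeg_eq]
    exact inferInstanceAs (Epi (H.map P.p))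
  refine hF.nonempty_isColimit (fun A B t _ ↦ inferInstanceAs (Epi (H.map (F.map t)))) P _ ?_
  simp only [kanLeg_eq]
  exact P.exact.map_of_epi_of_preservesCokernel H P.epi inferInstance

variable [F.PreservesZeroMorphisms] (hF : HasEnoughProjectiveLifts F) {H : C ⥤ D}
  [H.PreservesZeroMorphisms] [PreservesFiniteColimits H]

include hF

lemma HasEnoughProjectiveLifts.natTrans_ext {K : C ⥤ D} {β γ : H ⟶ K}
    (h : ∀ A, β.app (F.obj A) = γ.app (F.obj A)) : β = γ :=
  have := hF.isLeftKanExtension H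
  H.hom_ext_of_isLeftKanExtension (𝟙 (F ⋙ H)) _ _ (by ext A; simpa using h A)

lemma HasEnoughProjectiveLifts.exists_iso {K : C ⥤ D} [K.PreservesZeroMorphisms]
    [PreservesFiniteColimits K] (e : F ⋙ H ≅ F ⋙ K) :
    ∃ θ : H ≅ K, ∀ A, θ.hom.app (F.obj A) = e.hom.app A := by
  have := hF.isLeftKanExtension H
  have := hF.isLeftKanExtension K
  refine ⟨H.leftKanExtensionUniqueOfIso (𝟙 _) e K (𝟙 _), fun A ↦ ?_⟩
  simpa using H.descOfIsLeftKanExtension_fac_app (𝟙 (F ⋙ H)) K (e.hom ≫ 𝟙 _) A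

end Cocone

variable [Preadditive T]

/-- `G` is exact relative to `F` if it maps the complexes that become exact under `F` to exact
complexes. -/
def IsRelExact (F : T ⥤ C) [F.PreservesZeroMorphisms] (G : T ⥤ D) [G.PreservesZeroMorphisms] :
    Prop :=
  ∀ S : ShortComplex T, (S.map F).Exact → (S.map G).Exact

namespace IsRelExact

variable [F.Additive] [G.Additive] (hG : IsRelExact F G) (hF : HasEnoughProjectiveLifts F)

include hG

lemma epi_map {A B : T} (f : A ⟶ B) (hf : Epi (F.map f)) : Epi (G.map f) := by
  have h := hG (ShortComplex.mk f (0 : B ⟶ B) comp_zero)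
    ((ShortComplex.exact_iff_epi _ (F.map_zero _ _)).2 hf)
  exact (ShortComplex.exact_iff_epi _ (G.map_zero _ _)).1 h

include hF

lemma hom_ext {A : T} {W : D} {f g : G.obj A ⟶ W}
    (h : ∀ ⦃Q : T⦄ (_ : IsProjectiveLift F Q) (z : Q ⟶ A), G.map z ≫ f = G.map z ≫ g) :
    f = g := by
  obtain ⟨Q, z, hQ, hz⟩ := hF.exists_epi_map A
  have := hG.epi_map z hz
  rw [← cancel_epi (G.map z), h hQ]

lemma exists_component {X : C} (P : LiftedPresentation F X) {A : T} (x : F.obj A ⟶ X) :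
    ∃ k : G.obj A ⟶ cokernel (G.map P.a), ∀ ⦃Q : T⦄ (_ : IsProjectiveLift F Q) (z : Q ⟶ A)
      (y : Q ⟶ P.Q₀), F.map y ≫ P.p = F.map z ≫ x →
        G.map z ≫ k = G.map y ≫ cokernel.π (G.map P.a) := by
  obtain ⟨Q, t, hQ, ht⟩ := hF.exists_epi_map A
  obtain ⟨y₀, hy₀⟩ := hQ.exists_map_comp_eq P.p (F.map t ≫ x)
  obtain ⟨Q', b, hQ', w, hb⟩ := hF.exists_exact (F.map t)
  have hbt : b ≫ t = 0 := hQ'.map_injective (by rw [F.map_comp, w, F.map_zero])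
  have exact_G : ((ShortComplex.mk b t hbt).map G).Exact := hG _ hb
  have : Epi ((ShortComplex.mk b t hbt).map G).g := hG.epi_map t ht
  have hz : G.map b ≫ G.map y₀ ≫ cokernel.π (G.map P.a) = 0 := by
    rw [← Category.assoc, ← G.map_comp]
    apply P.map_comp_eq_zero (cokernel.condition _) hQ'
    rw [F.map_comp, Category.assoc, hy₀, reassoc_of% w, zero_comp]
  obtain ⟨k, hk⟩ : ∃ k : G.obj A ⟶ cokernel (G.map P.a),
      G.map t ≫ k = G.map y₀ ≫ cokernel.π (G.map P.a) :=
    ⟨exact_G.desc _ hz, exact_G.g_desc _ hz⟩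
  refine ⟨k, fun R hR z y hzy ↦ ?_⟩
  obtain ⟨s, rfl⟩ := hR.exists_comp_eq t z
  rw [G.map_comp, Category.assoc, hk, ← sub_eq_zero, ← Category.assoc, ← G.map_comp,
    ← Preadditive.sub_comp, ← G.map_sub]
  apply P.map_comp_eq_zero (cokernel.condition _) hR
  rw [F.map_sub, Preadditive.sub_comp, F.map_comp, Category.assoc, hy₀, hzy, F.map_comp,
    Category.assoc, sub_self]

lemma exists_cocone {X : C} (P : LiftedPresentation F X) :
    ∃ (c : Cocone (CostructuredArrow.proj F X ⋙ G)) (_ : IsColimit c) (_ : Epi (kanLeg c P.p)),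
      (ShortComplex.mk _ _ (P.map_comp_kanLeg c)).Exact := by
  choose k hk using fun A (x : F.obj A ⟶ X) ↦ hG.exists_component hF P x
  have map_comp_k {A B : T} (t : A ⟶ B) (x : F.obj B ⟶ X) :
      G.map t ≫ k B x = k A (F.map t ≫ x) :=
    hG.hom_ext hF fun Q hQ z ↦ by
      obtain ⟨y, hy⟩ := hQ.exists_map_comp_eq P.p (F.map z ≫ F.map t ≫ x)
      rw [hk _ _ hQ z y hy, ← Category.assoc, ← G.map_comp,
        hk _ _ hQ (z ≫ t) y (by rw [hy, F.map_comp, Category.assoc])]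
  let c : Cocone (CostructuredArrow.proj F X ⋙ G) :=
    { pt := cokernel (G.map P.a)
      ι :=
        { app := fun x ↦ k x.left x.hom
          naturality := fun x x' t ↦ by
            have h := map_comp_k t.left x'.hom
            rw [CostructuredArrow.w] at h
            exact h.trans (Category.comp_id _).symm } }
  have kanLeg_p : kanLeg c P.p = cokernel.π (G.map P.a) :=
    hG.hom_ext hF fun Q hQ z ↦ hk _ _ hQ z z rfl
  have epi_p : Epi (kanLeg c P.p) := by
    rw [kanLeg_p]
    exact inferInstanceAs (Epi (cokernel.π _))
  have hc : (ShortComplex.mk _ _ (P.map_comp_kanLeg c)).Exact := by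
    simp only [kanLeg_p]
    exact ShortComplex.exact_cokernel _
  exact ⟨c, (hF.nonempty_isColimit (fun _ _ ↦ hG.epi_map) P c hc).some, epi_p, hc⟩

lemma hasPointwiseLeftKanExtension : F.HasPointwiseLeftKanExtension G := fun X ↦ by
  obtain ⟨P⟩ := hF.nonempty_liftedPresentation X
  obtain ⟨c, hc, -⟩ := hG.exists_cocone hF P
  exact ⟨c, hc⟩

end IsRelExact

lemma IsRelExact.exists_comp_map_eq [HasBinaryBiproducts T] {F : T ⥤ C} [F.Additive] {G : T ⥤ D}
    [G.Additive] (hG : IsRelExact F G) (hF : HasEnoughProjectiveLifts F) {A B X : T} (f : A ⟶ X)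
    (g : B ⟶ X) {R : D} (a : R ⟶ G.obj A) (b : R ⟶ G.obj B) (hab : a ≫ G.map f = b ≫ G.map g) :
    ∃ (Q : T) (s : Q ⟶ A) (t : Q ⟶ B) (R' : D) (π : R' ⟶ R) (c : R' ⟶ G.obj Q),
      IsProjectiveLift F Q ∧ s ≫ f = t ≫ g ∧ Epi π ∧ π ≫ a = c ≫ G.map s := by
  obtain ⟨Q, q, hQ, w, hq⟩ := hF.exists_exact (F.map (biprod.desc f (-g)))
  have hqfg : q ≫ biprod.desc f (-g) = 0 := hQ.map_injective (by rw [F.map_comp, w, F.map_zero])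
  have exact_G := hG (ShortComplex.mk q _ hqfg) hq
  have hab' : (a ≫ G.map biprod.inl + b ≫ G.map biprod.inr) ≫ G.map (biprod.desc f (-g)) = 0 := by
    simp only [Preadditive.add_comp, Category.assoc, ← G.map_comp, biprod.inl_desc,
      biprod.inr_desc, G.map_neg, Preadditive.comp_neg, hab, add_neg_cancel]
  obtain ⟨R', π, hπ, (c : R' ⟶ G.obj Q), hc⟩ := exact_G.exact_up_to_refinements _ hab'
  replace hc : (π ≫ (a ≫ G.map biprod.inl + b ≫ G.map biprod.inr)) ≫ G.map biprod.fst =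
      (c ≫ G.map q) ≫ G.map biprod.fst := congrArg (· ≫ G.map biprod.fst) hc
  refine ⟨Q, q ≫ biprod.fst, q ≫ biprod.snd, R', π, c, hQ, ?_, hπ, ?_⟩
  · rwa [biprod.desc_eq, Preadditive.comp_add, Preadditive.comp_neg, Preadditive.comp_neg,
      add_neg_eq_zero, ← Category.assoc, ← Category.assoc] at hqfg
  · simpa only [Preadditive.add_comp, Preadditive.comp_add, Category.assoc, ← G.map_comp,
      biprod.inl_fst, biprod.inr_fst, G.map_id, G.map_zero, comp_zero, add_zero,
      Category.comp_id] using hc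

namespace IsRelExact

variable {F : T ⥤ C} [F.Additive] {G : T ⥤ D} [G.Additive] (hG : IsRelExact F G)
  (hF : HasEnoughProjectiveLifts F) {E : C ⥤ D} (η : G ⟶ F ⋙ E)

variable [E.IsLeftKanExtension η]

include hG hF in
lemma exact_presentation {X : C} (P : LiftedPresentation F X) :
    ∃ (_ : Epi (η.app P.Q₀ ≫ E.map P.p)) (w : G.map P.a ≫ η.app P.Q₀ ≫ E.map P.p = 0),
      (ShortComplex.mk _ _ w).Exact := by
  have := hG.hasPointwiseLeftKanExtension hF
  obtain ⟨c, hc, epi_p, exact_c⟩ := hG.exists_cocone hF P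
  let e : c.pt ≅ E.obj X := hc.coconePointUniqueUpToIso
    (Functor.isPointwiseLeftKanExtensionOfIsLeftKanExtension E η X)
  have he : kanLeg c P.p ≫ e.hom = η.app P.Q₀ ≫ E.map P.p :=
    hc.comp_coconePointUniqueUpToIso_hom _ _
  have w : G.map P.a ≫ η.app P.Q₀ ≫ E.map P.p = 0 := by
    rw [map_comp_unit_comp_map, P.zero, unit_comp_map_zero]
  refine ⟨he ▸ epi_comp _ _, w, ShortComplex.exact_of_iso ?_ exact_c⟩
  exact ShortComplex.isoMk (Iso.refl _) (Iso.refl _) e (by simp)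
    ((Category.id_comp _).trans he.symm)

include hG hF η in
lemma additive_of_isLeftKanExtension : E.Additive where
  map_add {X Y f g} := by
    obtain ⟨P⟩ := hF.nonempty_liftedPresentation X
    obtain ⟨P'⟩ := hF.nonempty_liftedPresentation Y
    obtain ⟨a, ha⟩ := P.isProjectiveLift.exists_map_comp_eq P'.p (P.p ≫ f)
    obtain ⟨b, hb⟩ := P.isProjectiveLift.exists_map_comp_eq P'.p (P.p ≫ g)
    obtain ⟨h, -⟩ := hG.exact_presentation hF η P
    rw [← cancel_epi (η.app P.Q₀ ≫ E.map P.p), Preadditive.comp_add]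
    simp only [Category.assoc, ← E.map_comp, Preadditive.comp_add, ← ha, ← hb]
    rw [← Preadditive.add_comp, ← F.map_add, ← map_comp_unit_comp_map, ← map_comp_unit_comp_map,
      ← map_comp_unit_comp_map, G.map_add, Preadditive.add_comp]

variable [HasBinaryBiproducts T]

include hG hF in
/-- Pull the relations of a presentation of `Z` back along `Q ⟶ A` for a projective lift `Q`. -/
lemma exact_unit_comp_map {A B : T} {f : B ⟶ A} {Z : C} {x : F.obj A ⟶ Z} {w : F.map f ≫ x = 0}
    (h : (ShortComplex.mk _ _ w).Exact) :
    ∃ w' : G.map f ≫ η.app A ≫ E.map x = 0, (ShortComplex.mk _ _ w').Exact := by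
  refine ⟨by rw [map_comp_unit_comp_map, w, unit_comp_map_zero],
    (ShortComplex.exact_iff_exact_up_to_refinements _).2 fun R y hy ↦ ?_⟩
  dsimp only at y hy
  obtain ⟨P⟩ := hF.nonempty_liftedPresentation Z
  obtain ⟨-, w_P, exact_P⟩ := hG.exact_presentation hF η P
  obtain ⟨Q, t, hQ, ht⟩ := hF.exists_epi_map A
  obtain ⟨c, hc⟩ := hQ.exists_map_comp_eq P.p (F.map t ≫ x)
  have := hG.epi_map t ht
  obtain ⟨R₁, π₁, _, y₁, hy₁⟩ := surjective_up_to_refinements_of_epi (G.map t) y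
  have hy₁c : (y₁ ≫ G.map c) ≫ η.app P.Q₀ ≫ E.map P.p = 0 := by
    rw [Category.assoc, map_comp_unit_comp_map, hc, ← map_comp_unit_comp_map, ← Category.assoc,
      ← hy₁, Category.assoc, hy, comp_zero]
  obtain ⟨R₂, π₂, _, z, hz⟩ := exact_P.exact_up_to_refinements _ hy₁c
  obtain ⟨Q', s, s', R₃, π₃, v, hQ', hs, _, hv⟩ :=
    hG.exists_comp_map_eq hF c P.a (π₂ ≫ y₁) z (by rw [Category.assoc, hz])
  have hst : F.map (s ≫ t) ≫ x = 0 := by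
    rw [F.map_comp, Category.assoc, ← hc, ← Category.assoc, ← F.map_comp, hs, F.map_comp,
      Category.assoc, P.zero, comp_zero]
  obtain ⟨r, hr⟩ := hQ'.exists_comp_eq_of_exact h (s ≫ t) hst
  refine ⟨R₃, π₃ ≫ π₂ ≫ π₁, inferInstance, v ≫ G.map r, ?_⟩
  simp only [Category.assoc, hy₁]
  rw [reassoc_of% hv, ← G.map_comp, ← G.map_comp, hr]

include hG hF in
lemma isIso_unit : IsIso η := by
  suffices ∀ A, IsIso (η.app A) from NatIso.isIso_of_isIso_app η
  intro A
  have mono_η : Mono (η.app A) := by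
    have exact_id : (ShortComplex.mk (F.map (0 : A ⟶ A)) (𝟙 (F.obj A)) (by simp)).Exact :=
      (ShortComplex.exact_iff_mono _ (F.map_zero A A)).2 inferInstance
    obtain ⟨w, h⟩ := hG.exact_unit_comp_map hF η exact_id
    simpa using (ShortComplex.exact_iff_mono _ (G.map_zero A A)).1 h
  have epi_η : Epi (η.app A) := by
    obtain ⟨P⟩ := hF.nonempty_liftedPresentation (F.obj A)
    obtain ⟨t, ht⟩ := P.isProjectiveLift.map_surjective P.p
    obtain ⟨h, -⟩ := hG.exact_presentation hF η P
    have h' : Epi (η.app P.Q₀ ≫ (F ⋙ E).map t) := by rwa [← ht] at h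
    exact epi_of_epi_fac (η.naturality t)
  exact isIso_of_mono_of_epi _

include hG hF η in
lemma exact_map_of_isLeftKanExtension [E.PreservesZeroMorphisms] (S : ShortComplex C)
    (hS : S.Exact) : (S.map E).Exact := by
  refine (ShortComplex.exact_iff_exact_up_to_refinements _).2 fun R y hy ↦ ?_
  change R ⟶ E.obj S.X₂ at y
  change y ≫ E.map S.g = 0 at hy
  obtain ⟨P⟩ := hF.nonempty_liftedPresentation S.X₂
  obtain ⟨_, -⟩ := hG.exact_presentation hF η P
  obtain ⟨Q, b, hQ, w, hb⟩ := hF.exists_exact (P.p ≫ S.g)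
  obtain ⟨w', exact_b⟩ := hG.exact_unit_comp_map hF η hb
  obtain ⟨R₁, π₁, _, y₁, hy₁⟩ :=
    surjective_up_to_refinements_of_epi (η.app P.Q₀ ≫ E.map P.p) y
  have hy₁' : y₁ ≫ η.app P.Q₀ ≫ E.map (P.p ≫ S.g) = 0 := by
    rw [E.map_comp, ← Category.assoc (η.app _), ← Category.assoc, ← hy₁, Category.assoc, hy,
      comp_zero]
  obtain ⟨R₂, π₂, _, v, hv⟩ := exact_b.exact_up_to_refinements y₁ hy₁'
  replace hv : π₂ ≫ y₁ = v ≫ G.map b := hv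
  have := hQ.projective
  let l : F.obj Q ⟶ S.X₁ := hS.liftFromProjective (F.map b ≫ P.p) (by rw [Category.assoc, w])
  have hl : l ≫ S.f = F.map b ≫ P.p := hS.liftFromProjective_comp _ _
  refine ⟨R₂, π₂ ≫ π₁, inferInstance, v ≫ η.app Q ≫ E.map l, ?_⟩
  change (π₂ ≫ π₁) ≫ y = (v ≫ η.app Q ≫ E.map l) ≫ E.map S.f
  rw [Category.assoc, hy₁, reassoc_of% hv, map_comp_unit_comp_map, ← hl, E.map_comp]
  simp only [Category.assoc]

omit [E.IsLeftKanExtension η] in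
include hG hF in
lemma exists_exact_extension :
    ∃ (E : C ⥤ D) (_ : PreservesFiniteLimits E) (_ : PreservesFiniteColimits E),
      Nonempty (F ⋙ E ≅ G) := by
  have := hG.hasPointwiseLeftKanExtension hF
  let E := F.leftKanExtension G
  let η : G ⟶ F ⋙ E := F.leftKanExtensionUnit G
  have : IsIso η := hG.isIso_unit hF η
  have : E.Additive := hG.additive_of_isLeftKanExtension hF η
  obtain ⟨h₁, h₂⟩ := (E.exact_tfae.out 1 3).1 (hG.exact_map_of_isLeftKanExtension hF η)
  exact ⟨E, h₁, h₂, ⟨(asIso η).symm⟩⟩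

end IsRelExact

end KanExtension

/-! ### Homological functors with enough projective lifts -/

section Homological

variable {T : Type u} [Category.{v} T] [Preadditive T]
  [HasZeroObject T] [HasShift T ℤ] [∀ n : ℤ, (shiftFunctor T n).Additive] [Pretriangulated T]
  {C : Type u'} [Category.{v'} C] [Abelian C] {F : T ⥤ C} [F.IsHomological]
  {D : Type u''} [Category.{v''} D] [Abelian D] {G : T ⥤ D} [G.IsHomological]

lemma map_eq_zero_of_epi_map {A B X : T} {f : A ⟶ B} {g : B ⟶ X} {h : X ⟶ A⟦(1 : ℤ)⟧}
    (hT : Triangle.mk f g h ∈ distTriang T) [Epi (F.map f)] : F.map g = 0 := by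
  have w : f ≫ g = 0 := comp_distTriang_mor_zero₁₂ _ hT
  rw [← cancel_epi (F.map f), ← F.map_comp, w, F.map_zero, comp_zero]

lemma epi_map_of_map_eq_zero {A B X : T} {f : A ⟶ B} {g : B ⟶ X} {h : X ⟶ A⟦(1 : ℤ)⟧}
    (hT : Triangle.mk f g h ∈ distTriang T) (hg : G.map g = 0) : Epi (G.map f) :=
  (ShortComplex.exact_iff_epi _ hg).1 (G.map_distinguished_exact _ hT)

lemma epi_map_of_ker_le (hk : ∀ ⦃A B : T⦄ (f : A ⟶ B), F.map f = 0 → G.map f = 0)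
    {A B : T} (f : A ⟶ B) [Epi (F.map f)] : Epi (G.map f) := by
  obtain ⟨X, g, h, hT⟩ := distinguished_cocone_triangle f
  exact epi_map_of_map_eq_zero hT (hk g (map_eq_zero_of_epi_map hT))

/-- Replace the left end of a complex `A ⟶ B ⟶ X` by a fibre `N` of `B ⟶ X`, for which exactness is
automatic, and then `N` by a projective lift, which factors through `A`. -/
lemma HasEnoughProjectiveLifts.isRelExact (hF : HasEnoughProjectiveLifts F)
    (hk : ∀ ⦃A B : T⦄ (f : A ⟶ B), F.map f = 0 → G.map f = 0) : IsRelExact F G := by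
  intro S hS
  obtain ⟨N, i, h, hT⟩ := distinguished_cocone_triangle₁ S.g
  have w : i ≫ S.g = 0 := comp_distTriang_mor_zero₁₂ _ hT
  obtain ⟨Q, q, hQ, hq⟩ := hF.exists_epi_map N
  obtain ⟨t, ht⟩ := hQ.exists_comp_eq_of_exact (f := S.f) (g := F.map S.g) hS (q ≫ i)
    (by rw [← F.map_comp, Category.assoc, w, comp_zero, F.map_zero])
  have := epi_map_of_ker_le hk q
  refine (ShortComplex.exact_iff_exact_up_to_refinements _).2 fun R x hx ↦ ?_
  change R ⟶ G.obj S.X₂ at x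
  obtain ⟨R₁, π₁, _, (x₁ : R₁ ⟶ G.obj N), h₁⟩ :=
    (G.map_distinguished_exact _ hT).exact_up_to_refinements x hx
  replace h₁ : π₁ ≫ x = x₁ ≫ G.map i := h₁
  obtain ⟨R₂, π₂, _, x₂, h₂⟩ := surjective_up_to_refinements_of_epi (G.map q) x₁
  refine ⟨R₂, π₂ ≫ π₁, inferInstance, x₂ ≫ G.map t, ?_⟩
  change (π₂ ≫ π₁) ≫ x = (x₂ ≫ G.map t) ≫ G.map S.f
  rw [Category.assoc, h₁, reassoc_of% h₂, Category.assoc, ← G.map_comp, ← G.map_comp, ht]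

end Homological

section Stable

variable {T : Type u} [Category.{v} T] [Preadditive T]
  [HasZeroObject T] [HasShift T ℤ] [∀ n : ℤ, (shiftFunctor T n).Additive] [Pretriangulated T]
  {C : Type u'} [Category.{v'} C] [Abelian C] [StableCategory C]

attribute [instance] StableHomologicalFunctor.isHomological StableExactFunctor.preservesFiniteLimits
  StableExactFunctor.preservesFiniteColimits StableCategory.additive

instance {D : Type u''} [Category.{v''} D] [Abelian D] [StableCategory D]
    (H : StableExactFunctor C D) : H.functor.PreservesZeroMorphisms :=
  Functor.preservesZeroMorphisms_of_preserves_initial_object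

lemma MorphismIdeal.mem_kerStable_iff (F : StableHomologicalFunctor T C) {A B : T} (f : A ⟶ B) :
    f ∈ (kerStable F).hom A B ↔ F.functor.map f = 0 := Iff.rfl

section Factorization

variable {F : StableHomologicalFunctor T C} (hF : HasEnoughProjectiveLifts F.functor)
  {D : Type u''} [Category.{v''} D] [Abelian D] [StableCategory D]
  {G : StableHomologicalFunctor T D}

include hF

lemma HasEnoughProjectiveLifts.nonempty_stableFactorization_of_iso (H : C ⥤ D)
    [PreservesFiniteLimits H] [PreservesFiniteColimits H] (e : F.functor ⋙ H ≅ G.functor) :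
    Nonempty (StableFactorization F G) := by
  have : H.PreservesZeroMorphisms := Functor.preservesZeroMorphisms_of_preserves_initial_object
  let i : F.functor ⋙ susp C ⋙ H ≅ F.functor ⋙ H ⋙ susp D :=
    (Functor.associator _ _ _).symm ≪≫ Functor.isoWhiskerRight F.suspIso.symm H ≪≫
      Functor.isoWhiskerLeft (susp T) e ≪≫ G.suspIso ≪≫ Functor.isoWhiskerRight e.symm (susp D)
  obtain ⟨θ, hθ⟩ := hF.exists_iso i
  exact ⟨{
    lift := ⟨H, ‹_›, ‹_›, θ⟩
    iso := e
    iso_susp := fun A ↦ by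
      dsimp only
      rw [hθ]
      simp [i, ← Functor.map_comp, ← Functor.map_comp_assoc] }⟩

lemma HasEnoughProjectiveLifts.nonempty_stableFactorization
    (hG : (MorphismIdeal.kerStable F).IsExact G.functor) : Nonempty (StableFactorization F G) := by
  obtain ⟨H, _, _, ⟨e⟩⟩ := (hF.isRelExact (G := G.functor) hG).exists_exact_extension hF
  exact hF.nonempty_stableFactorization_of_iso H e

lemma HasEnoughProjectiveLifts.exists_iso_of_stableFactorization (Φ Ψ : StableFactorization F G) :
    ∃ θ : Φ.lift.functor ≅ Ψ.lift.functor,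
      (∀ A : T, θ.hom.app (F.functor.obj A) ≫ Ψ.iso.hom.app A = Φ.iso.hom.app A) ∧
      (∀ X : C, θ.hom.app ((susp C).obj X) ≫ Ψ.lift.suspIso.hom.app X =
        Φ.lift.suspIso.hom.app X ≫ (susp D).map (θ.hom.app X)) := by
  obtain ⟨θ, hθ⟩ := hF.exists_iso (Φ.iso ≪≫ Ψ.iso.symm)
  have fac (A : T) : θ.hom.app (F.functor.obj A) ≫ Ψ.iso.hom.app A = Φ.iso.hom.app A := by
    simp [hθ]
  refine ⟨θ, fac, NatTrans.congr_app (hF.natTrans_ext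
    (β := Functor.whiskerLeft (susp C) θ.hom ≫ Ψ.lift.suspIso.hom)
    (γ := Φ.lift.suspIso.hom ≫ Functor.whiskerRight θ.hom (susp D)) fun A ↦ ?_)⟩
  have naturality := θ.hom.naturality (F.suspIso.hom.app A)
  dsimp at naturality ⊢
  rw [← cancel_epi (Φ.lift.functor.map (F.suspIso.hom.app A)),
    ← cancel_mono ((susp D).map (Ψ.iso.hom.app A))]
  simp only [Category.assoc, ← Functor.map_comp, fac]
  rw [reassoc_of% naturality, ← Φ.iso_susp, ← Ψ.iso_susp]
  dsimp
  rw [← fac, Category.assoc]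

lemma HasEnoughProjectiveLifts.isUniversalExact :
    IsUniversalExact.{w, z} (MorphismIdeal.kerStable F) F where
  isExact _ _ _ hf := hf
  exists_factorization _ _ _ _ _ hG := hF.nonempty_stableFactorization hG
  unique _ _ _ _ _ _ Φ Ψ := hF.exists_iso_of_stableFactorization Φ Ψ

end Factorization

lemma IsProjectiveLift.isProjective_kerStable {F : StableHomologicalFunctor T C} {Q : T}
    (hQ : IsProjectiveLift F.functor Q) : (MorphismIdeal.kerStable F).IsProjective Q := by
  intro A B f hf
  rw [MorphismIdeal.mem_kerStable_iff] at hf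
  ext (x : Q ⟶ A)
  refine hQ.map_injective ?_
  change F.functor.map (x ≫ f) = F.functor.map 0
  rw [F.functor.map_comp, hf, comp_zero, F.functor.map_zero]

lemma HasEnoughProjectiveLifts.hasEnoughProjectives_kerStable {F : StableHomologicalFunctor T C}
    (hF : HasEnoughProjectiveLifts F.functor) :
    (MorphismIdeal.kerStable F).HasEnoughProjectives := fun A ↦ by
  obtain ⟨Q, q, hQ, hq⟩ := hF.exists_epi_map A
  obtain ⟨X, g, h, hT⟩ := distinguished_cocone_triangle q
  exact ⟨Q, q, hQ.isProjective_kerStable, X, g, h, hT, map_eq_zero_of_epi_map hT⟩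

end Stable

/-! ### The partial left adjoint -/

section PartialLeftAdjoint

variable {T : Type u} [Category.{v} T] {C : Type u'} [Category.{v'} C] {F : T ⥤ C}

/-- The component at `X` of the unit of the partial left adjoint of `F`. -/
noncomputable def partialLeftAdjointUnitApp (X : F.PartialLeftAdjointSource) :
    X.obj ⟶ F.obj (F.partialLeftAdjointObj X) :=
  F.partialLeftAdjointHomEquiv (𝟙 _)

lemma partialLeftAdjointUnitApp_comp_map (X : F.PartialLeftAdjointSource) {Y : T}
    (f : F.partialLeftAdjointObj X ⟶ Y) :
    partialLeftAdjointUnitApp X ≫ F.map f = F.partialLeftAdjointHomEquiv f := by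
  rw [partialLeftAdjointUnitApp, ← Functor.partialLeftAdjointHomEquiv_comp, Category.id_comp]

variable (F) in
/-- The unit of the partial left adjoint of `F`, on its domain of definition. -/
noncomputable def partialLeftAdjointUnit :
    F.leftAdjointObjIsDefined.ι ⟶ F.partialLeftAdjoint ⋙ F where
  app := partialLeftAdjointUnitApp
  naturality X Y f := by
    change f.hom ≫ partialLeftAdjointUnitApp Y =
      partialLeftAdjointUnitApp X ≫ F.map (F.partialLeftAdjointMap f)
    rw [partialLeftAdjointUnitApp_comp_map, Functor.partialLeftAdjointHomEquiv_map,
      partialLeftAdjointUnitApp]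

namespace IsProjectiveLift

variable {Q : T} (hQ : IsProjectiveLift F Q)

include hQ

lemma isCorepresentable {P : C} (e : F.obj Q ≅ P) :
    (F ⋙ coyoneda.obj (Opposite.op P)).IsCorepresentable := by
  refine ⟨Q, ⟨⟨fun {B} ↦ (Equiv.ofBijective _ (hQ.bijective B)).trans e.homFromEquiv, ?_⟩⟩⟩
  intro Y Y' g f
  simp [Iso.homFromEquiv]

lemma isIso_partialLeftAdjointUnitApp (X : F.PartialLeftAdjointSource) (e : F.obj Q ≅ X.obj) :
    IsIso (partialLeftAdjointUnitApp X) := by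
  let f : F.partialLeftAdjointObj X ⟶ Q := F.partialLeftAdjointHomEquiv.symm e.inv
  have hf : partialLeftAdjointUnitApp X ≫ F.map f = e.inv := by
    rw [partialLeftAdjointUnitApp_comp_map, Equiv.apply_symm_apply]
  obtain ⟨g, hg⟩ := hQ.map_surjective (e.hom ≫ partialLeftAdjointUnitApp X)
  have hfg : f ≫ g = 𝟙 _ := by
    apply F.partialLeftAdjointHomEquiv.injective
    rw [← partialLeftAdjointUnitApp_comp_map, F.map_comp, reassoc_of% hf, hg,
      Iso.inv_hom_id_assoc, partialLeftAdjointUnitApp]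
  refine ⟨F.map f ≫ e.hom, by rw [reassoc_of% hf, Iso.inv_hom_id], ?_⟩
  rw [Category.assoc, ← hg, ← F.map_comp, hfg, F.map_id]

end IsProjectiveLift

lemma isProjectiveLift_of_isIso_unitApp (X : F.PartialLeftAdjointSource) [Projective X.obj]
    [IsIso (partialLeftAdjointUnitApp X)] :
    IsProjectiveLift F (F.partialLeftAdjointObj X) where
  projective := Projective.of_iso (asIso (partialLeftAdjointUnitApp X)) ‹_›
  bijective B := by
    let e : (F.obj (F.partialLeftAdjointObj X) ⟶ F.obj B) ≃ (X.obj ⟶ F.obj B) :=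
      (asIso (partialLeftAdjointUnitApp X)).homFromEquiv.symm
    have h : e ∘ F.map = F.partialLeftAdjointHomEquiv (X := X) (Y := B) :=
      funext fun f ↦ partialLeftAdjointUnitApp_comp_map X f
    rw [← e.bijective.of_comp_iff', h]
    exact F.partialLeftAdjointHomEquiv.bijective

/-- Naturality makes a left inverse of a component of `e` commute with it. -/
lemma isIso_app_of_app_comp_eq_id {A : Type*} [Category* A] {J : A ⥤ C} [J.Full] (e : J ⟶ J)
    {M P : A} (a : M ≅ P) {s : J.obj M ⟶ J.obj M} (hs : e.app M ≫ s = 𝟙 _) :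
    IsIso (e.app P) := by
  obtain ⟨s, rfl⟩ := J.map_surjective s
  have : IsIso (e.app M) := ⟨J.map s, hs, (e.naturality s).trans hs⟩
  rw [← NatTrans.naturality_1 e a]
  infer_instance

/-- Composing the unit with an arbitrary isomorphism gives a natural endomorphism of the inclusion
of `S`. It is split mono at the objects in the image of `F`, by the triangle identity. -/
lemma isIso_unitApp_of_iso {S : ObjectProperty C} (h : S ≤ F.leftAdjointObjIsDefined)
    [S.IsClosedUnderIsomorphisms]
    (α : ObjectProperty.ιOfLE h ⋙ F.partialLeftAdjoint ⋙ F ≅ S.ι) (P : S.FullSubcategory) :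
    IsIso (partialLeftAdjointUnitApp ((ObjectProperty.ιOfLE h).obj P)) := by
  let u : S.ι ⟶ ObjectProperty.ιOfLE h ⋙ F.partialLeftAdjoint ⋙ F :=
    Functor.whiskerLeft (ObjectProperty.ιOfLE h) (partialLeftAdjointUnit F)
  let M : S.FullSubcategory := ⟨(ObjectProperty.ιOfLE h ⋙ F.partialLeftAdjoint ⋙ F).obj P,
    S.prop_of_iso (α.app P).symm P.property⟩
  let r : (ObjectProperty.ιOfLE h ⋙ F.partialLeftAdjoint ⋙ F).obj M ⟶ M.obj :=
    F.map (F.partialLeftAdjointHomEquiv.symm (𝟙 M.obj))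
  have hr : u.app M ≫ r = 𝟙 M.obj :=
    (partialLeftAdjointUnitApp_comp_map _ _).trans (Equiv.apply_symm_apply _ _)
  have : IsIso ((u ≫ α.hom).app P) := isIso_app_of_app_comp_eq_id (u ≫ α.hom)
    (M := M) (S.isoMk (α.app P)) (s := α.inv.app M ≫ r) (by simpa using hr)
  have hu : u = (u ≫ α.hom) ≫ α.inv := by simp
  change IsIso (u.app P)
  rw [hu, NatTrans.comp_app]
  infer_instance

lemma ProjectivesLift.le_leftAdjointObjIsDefined (hF : ProjectivesLift F) :
    isProjective C ≤ F.leftAdjointObjIsDefined := fun P (hP : Projective P) ↦ by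
  obtain ⟨Q, hQ, ⟨e⟩⟩ := hF P
  exact hQ.isCorepresentable e

lemma projectivesLift_iff : ProjectivesLift F ↔
    ∃ h : isProjective C ≤ F.leftAdjointObjIsDefined,
      Nonempty (ObjectProperty.ιOfLE h ⋙ F.partialLeftAdjoint ⋙ F ≅ (isProjective C).ι) := by
  constructor
  · intro hF
    have h := hF.le_leftAdjointObjIsDefined
    let u : (isProjective C).ι ⟶ ObjectProperty.ιOfLE h ⋙ F.partialLeftAdjoint ⋙ F :=
      Functor.whiskerLeft (ObjectProperty.ιOfLE h) (partialLeftAdjointUnit F)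
    have isIso_u (P) : IsIso (u.app P) := by
      have : Projective P.obj := P.property
      obtain ⟨Q, hQ, ⟨e⟩⟩ := hF P.obj
      exact hQ.isIso_partialLeftAdjointUnitApp _ e
    have := NatIso.isIso_of_isIso_app u
    exact ⟨h, ⟨(asIso u).symm⟩⟩
  · rintro ⟨h, ⟨α⟩⟩ P hP
    have : (isProjective C).IsClosedUnderIsomorphisms := ⟨Projective.of_iso⟩
    let X : F.PartialLeftAdjointSource := ⟨P, h P hP⟩
    have : Projective X.obj := hP
    have : IsIso (partialLeftAdjointUnitApp X) := isIso_unitApp_of_iso h α ⟨P, hP⟩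
    exact ⟨_, isProjectiveLift_of_isIso_unitApp X, ⟨α.app ⟨P, hP⟩⟩⟩

end PartialLeftAdjoint

/-! ### Coherent objects -/

section CoherentObjects

variable {A : Type u} [Category.{v} A] [Abelian A]

/-- An object `X` is coherent with respect to a class `W` if it is a quotient of an object in `W`
and the kernel of every morphism from an object in `W` to `X` is such a quotient as well. -/
def IsCoherent (W : ObjectProperty A) : ObjectProperty A := fun X ↦
  (∃ (P : A) (p : P ⟶ X), W P ∧ Epi p) ∧
    ∀ ⦃P : A⦄ (f : P ⟶ X), W P → ∃ (Q : A) (q : Q ⟶ P) (w : q ≫ f = 0),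
      W Q ∧ (ShortComplex.mk q f w).Exact

/-- Objects of `W` have the lifting property with respect to quotients of objects in `W`; this is
all the projectivity that is needed for coherence with respect to `W` to pass to cokernels. -/
def IsRelativelyProjective (W : ObjectProperty A) : Prop :=
  ∀ ⦃P P' Z : A⦄ (c : P' ⟶ Z) [Epi c] (g : P ⟶ Z), W P → W P' → ∃ l : P ⟶ P', l ≫ c = g

variable {W : ObjectProperty A}

lemma IsRelativelyProjective.exists_lift (hW : IsRelativelyProjective W) {P Y Z : A}
    (hP : W P) (hY : IsCoherent W Y) (c : Y ⟶ Z) [Epi c] (g : P ⟶ Z) :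
    ∃ l : P ⟶ Y, l ≫ c = g := by
  obtain ⟨⟨P', p, hP', _⟩, -⟩ := hY
  obtain ⟨l, hl⟩ := hW (p ≫ c) g hP hP'
  exact ⟨l ≫ p, by rwa [Category.assoc]⟩

lemma exists_epi_of_exact_of_mono {K X Y : A} {k : K ⟶ X} {f : X ⟶ Y} {w : k ≫ f = 0}
    (h : (ShortComplex.mk k f w).Exact) [Mono k] (hX : IsCoherent W X) (hY : IsCoherent W Y) :
    ∃ (Q : A) (q : Q ⟶ K), W Q ∧ Epi q := by
  obtain ⟨⟨P, p, hP, _⟩, -⟩ := hX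
  obtain ⟨Q, q, wq, hQ, exact_q⟩ := hY.2 (p ≫ f) hP
  have hq : (q ≫ p) ≫ f = 0 := by rwa [Category.assoc]
  have hlift : h.lift (q ≫ p) hq ≫ k = q ≫ p := h.lift_f _ hq
  refine ⟨Q, h.lift (q ≫ p) hq, hQ, (epi_iff_surjective_up_to_refinements _).2 fun B y ↦ ?_⟩
  obtain ⟨B₁, π₁, _, x, hx⟩ := surjective_up_to_refinements_of_epi p (y ≫ k)
  obtain ⟨B₂, π₂, _, z, hz⟩ := exact_q.exact_up_to_refinements x (by
    dsimp only
    rw [← Category.assoc, ← hx, Category.assoc, Category.assoc, w, comp_zero, comp_zero])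
  dsimp only at hz
  refine ⟨B₂, π₂ ≫ π₁, inferInstance, z, ?_⟩
  rw [← cancel_mono k, Category.assoc, Category.assoc, Category.assoc, hx, hlift, reassoc_of% hz]

lemma isCoherent_of_exact_of_mono {K X Y : A} {k : K ⟶ X} {f : X ⟶ Y} {w : k ≫ f = 0}
    (h : (ShortComplex.mk k f w).Exact) [Mono k] (hX : IsCoherent W X) (hY : IsCoherent W Y) :
    IsCoherent W K := by
  refine ⟨exists_epi_of_exact_of_mono h hX hY, fun P g hP ↦ ?_⟩
  obtain ⟨Q, q, wq, hQ, exact_q⟩ := hX.2 (g ≫ k) hP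
  refine ⟨Q, q, by rw [← cancel_mono k, Category.assoc, wq, zero_comp], hQ,
    (ShortComplex.exact_iff_exact_up_to_refinements _).2 fun B x hx ↦
      exact_q.exact_up_to_refinements x ?_⟩
  dsimp only at hx ⊢
  rw [reassoc_of% hx, zero_comp]

instance : (IsCoherent W).IsClosedUnderIsomorphisms where
  of_iso {X _} e hX :=
    isCoherent_of_exact_of_mono (k := e.inv) (f := (0 : X ⟶ X)) (w := comp_zero)
      ((ShortComplex.exact_iff_epi _ rfl).2 (inferInstanceAs (Epi e.inv))) hX hX

instance : (IsCoherent W).IsClosedUnderKernels where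
  kernels_le := by
    rintro _ ⟨f, k, hk, hX, hY⟩
    have : Mono k.ι := Fork.IsLimit.mono hk
    exact isCoherent_of_exact_of_mono
      (ShortComplex.exact_of_f_is_kernel (ShortComplex.mk k.ι f k.condition)
        (IsLimit.ofIsoLimit hk (Fork.ext (Iso.refl _) (by simp)))) hX hY

section Biprod

variable (hW : ∀ ⦃P Q : A⦄, W P → W Q → W (P ⊞ Q))

include hW

lemma isCoherent_biprod {X Y : A} (hX : IsCoherent W X) (hY : IsCoherent W Y) :
    IsCoherent W (X ⊞ Y) := by
  refine ⟨?_, fun P g hP ↦ ?_⟩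
  · obtain ⟨⟨P, p, hP, _⟩, -⟩ := hX
    obtain ⟨⟨Q, q, hQ, _⟩, -⟩ := hY
    exact ⟨P ⊞ Q, biprod.map p q, hW hP hQ, inferInstance⟩
  · obtain ⟨Q₁, q₁, w₁, hQ₁, exact₁⟩ := hX.2 (g ≫ biprod.fst) hP
    obtain ⟨Q₂, q₂, w₂, hQ₂, exact₂⟩ := hY.2 (q₁ ≫ g ≫ biprod.snd) hQ₁
    have w : (q₂ ≫ q₁) ≫ g = 0 := by
      ext
      · simp [w₁]
      · simpa using w₂
    refine ⟨Q₂, q₂ ≫ q₁, w, hQ₂,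
      (ShortComplex.exact_iff_exact_up_to_refinements _).2 fun B x hx ↦ ?_⟩
    dsimp only at x hx ⊢
    obtain ⟨B₁, π₁, _, x₁, h₁⟩ := exact₁.exact_up_to_refinements x
      (by dsimp only; rw [reassoc_of% hx, zero_comp])
    dsimp only at h₁
    obtain ⟨B₂, π₂, _, x₂, h₂⟩ := exact₂.exact_up_to_refinements x₁
      (by dsimp only; rw [← reassoc_of% h₁, reassoc_of% hx, zero_comp, comp_zero])
    dsimp only at h₂
    exact ⟨B₂, π₂ ≫ π₁, inferInstance, x₂, by rw [Category.assoc, h₁, reassoc_of% h₂]⟩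

/-- A generalized element `x` of `P` maps to zero in `Z` iff `l x` comes from `R`; so the kernel of
`g` is the projection to `P` of the kernel of `P ⊞ R ⟶ Y`. -/
lemma exists_exact_of_exact_of_lift {P R Y Z : A} {r : R ⟶ Y} {c : Y ⟶ Z} {w : r ≫ c = 0}
    (h : (ShortComplex.mk r c w).Exact) (hY : IsCoherent W Y) (hP : W P) (hR : W R)
    {g : P ⟶ Z} {l : P ⟶ Y} (hl : l ≫ c = g) :
    ∃ (Q : A) (q : Q ⟶ P) (w' : q ≫ g = 0), W Q ∧ (ShortComplex.mk q g w').Exact := by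
  obtain ⟨Q, q, wq, hQ, exact_q⟩ := hY.2 (biprod.desc l r) (hW hP hR)
  have w' : (q ≫ biprod.fst) ≫ g = 0 := by
    have hdesc : biprod.desc l r ≫ c = biprod.fst ≫ g := by ext <;> simp [hl, w]
    rw [Category.assoc, ← hdesc, reassoc_of% wq, zero_comp]
  refine ⟨Q, q ≫ biprod.fst, w', hQ,
    (ShortComplex.exact_iff_exact_up_to_refinements _).2 fun B x hx ↦ ?_⟩
  dsimp only at x hx ⊢
  obtain ⟨B₁, π₁, _, y, hy⟩ := h.exact_up_to_refinements (x ≫ l)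
    (by dsimp only; rw [Category.assoc, hl, hx])
  dsimp only at y hy
  obtain ⟨B₂, π₂, _, s, hs⟩ := exact_q.exact_up_to_refinements (biprod.lift (π₁ ≫ x) (-y))
    (by simp [hy])
  exact ⟨B₂, π₂ ≫ π₁, inferInstance, s, by simpa using hs =≫ biprod.fst⟩

lemma isCoherent_of_exact_of_epi (hW' : IsRelativelyProjective W) {X Y Z : A} {f : X ⟶ Y}
    {c : Y ⟶ Z} {w : f ≫ c = 0} (h : (ShortComplex.mk f c w).Exact) [Epi c]
    (hX : IsCoherent W X) (hY : IsCoherent W Y) : IsCoherent W Z := by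
  refine ⟨?_, fun P g hP ↦ ?_⟩
  · obtain ⟨⟨P, p, hP, _⟩, -⟩ := hY
    exact ⟨P, p ≫ c, hP, inferInstance⟩
  · obtain ⟨⟨R, r, hR, _⟩, -⟩ := hX
    obtain ⟨l, hl⟩ := hW'.exists_lift hP hY c g
    have w' : (r ≫ f) ≫ c = 0 := by rw [Category.assoc, w, comp_zero]
    let φ : ShortComplex.mk (r ≫ f) c w' ⟶ ShortComplex.mk f c w :=
      { τ₁ := r, τ₂ := 𝟙 Y, τ₃ := 𝟙 Z }
    have : Epi φ.τ₁ := ‹Epi r›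
    have : IsIso φ.τ₂ := inferInstanceAs (IsIso (𝟙 Y))
    have : Mono φ.τ₃ := inferInstanceAs (Mono (𝟙 Z))
    exact exists_exact_of_exact_of_lift hW
      ((ShortComplex.exact_iff_of_epi_of_isIso_of_mono φ).2 h) hY hP hR hl

lemma isClosedUnderCokernels_isCoherent (hW' : IsRelativelyProjective W) :
    (IsCoherent W).IsClosedUnderCokernels where
  cokernels_le := by
    rintro _ ⟨f, k, hk, hX, hY⟩
    have : Epi k.π := Cofork.IsColimit.epi hk
    exact isCoherent_of_exact_of_epi hW hW'
      (ShortComplex.exact_of_g_is_cokernel (ShortComplex.mk f k.π k.condition)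
        (IsColimit.ofIsoColimit hk (Cofork.ext (Iso.refl _) (by simp)))) hX hY

end Biprod

lemma containsZero_isCoherent {Z : A} (hZ : IsZero Z) (hZW : W Z) :
    (IsCoherent W).ContainsZero where
  exists_zero := ⟨Z, hZ, ⟨Z, 𝟙 Z, hZW, inferInstance⟩, fun P _ hP ↦
    ⟨P, 𝟙 P, hZ.eq_of_tgt _ _, hP,
      (ShortComplex.exact_iff_epi _ (hZ.eq_of_tgt _ _)).2 (inferInstanceAs (Epi (𝟙 P)))⟩⟩

lemma isClosedUnderFiniteProducts_isCoherent {Z : A} (hZ : IsZero Z) (hZW : W Z)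
    (hW : ∀ ⦃P Q : A⦄, W P → W Q → W (P ⊞ Q)) : (IsCoherent W).IsClosedUnderFiniteProducts :=
  have := containsZero_isCoherent hZ hZW
  have : (IsCoherent W).IsClosedUnderBinaryProducts := ⟨fun _ ⟨p⟩ ↦
    (IsCoherent W).prop_of_iso
      (IsLimit.conePointsIsoOfNatIso (BinaryBiproduct.isLimit _ _) p.isLimit
        (diagramIsoPair p.diag).symm)
      (isCoherent_biprod hW (p.prop_diag_obj _) (p.prop_diag_obj _))⟩
  .mk'

end CoherentObjects

/-! ### The restricted Yoneda functor -/

section RestrictedYoneda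

lemma exact_iff_forall_exact_map_evaluation {J : Type u} [Category.{v} J] {A : Type u'}
    [Category.{v'} A] [Abelian A] (S : ShortComplex (J ⥤ A)) :
    S.Exact ↔ ∀ j : J, (S.map ((evaluation J A).obj j)).Exact := by
  simp only [ShortComplex.exact_iff_isZero_homology, Functor.isZero_iff]
  exact forall_congr' fun j ↦ (S.mapHomologyIso ((evaluation J A).obj j)).symm.isZero_iff

variable {T : Type u} [Category.{v} T] [Preadditive T] (R : ObjectProperty T)

/-- The Yoneda functor restricted to a full subcategory: it maps `B` to the functor
`P ↦ (P ⟶ B)` on the objects `P` in `R`. -/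
def restrictedYoneda : T ⥤ R.FullSubcategoryᵒᵖ ⥤ AddCommGrpCat.{v} where
  obj B :=
    { obj P := AddCommGrpCat.of (P.unop.obj ⟶ B)
      map f := AddCommGrpCat.ofHom (Preadditive.leftComp B f.unop.hom)
      map_id P := by ext (x : P.unop.obj ⟶ B); exact Category.id_comp x
      map_comp f g := by ext (x : _ ⟶ B); exact Category.assoc _ _ x }
  map g :=
    { app P := AddCommGrpCat.ofHom (Preadditive.rightComp P.unop.obj g)
      naturality P P' f := by ext (x : _ ⟶ _); exact Category.assoc f.unop.hom x g }
  map_id B := by ext P (x : P.unop.obj ⟶ B); exact Category.comp_id x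
  map_comp f g := by ext P (x : P.unop.obj ⟶ _); exact (Category.assoc x f g).symm

instance : (restrictedYoneda R).Additive where
  map_add {X Y f g} := by ext P (x : P.unop.obj ⟶ _); exact Preadditive.comp_add _ _ _ x f g

lemma exact_map_restrictedYoneda_iff (S : ShortComplex T) : (S.map (restrictedYoneda R)).Exact ↔
    ∀ ⦃P : T⦄ (_ : R P) (x : P ⟶ S.X₂), x ≫ S.g = 0 → ∃ y : P ⟶ S.X₁, y ≫ S.f = x := by
  rw [exact_iff_forall_exact_map_evaluation]
  constructor
  · intro h P hP
    exact (ShortComplex.ab_exact_iff _).1 (h (.op ⟨P, hP⟩))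
  · intro h P
    exact (ShortComplex.ab_exact_iff _).2 (h P.unop.property)

lemma epi_restrictedYoneda_map_iff {A B : T} (f : A ⟶ B) : Epi ((restrictedYoneda R).map f) ↔
    ∀ ⦃P : T⦄ (_ : R P) (x : P ⟶ B), ∃ y : P ⟶ A, y ≫ f = x := by
  rw [NatTrans.epi_iff_epi_app]
  constructor
  · intro h P hP
    exact (AddCommGrpCat.epi_iff_surjective _).1 (h (.op ⟨P, hP⟩))
  · intro h P
    exact (AddCommGrpCat.epi_iff_surjective _).2 (h P.unop.property)

lemma restrictedYoneda_map_eq_zero_iff {A B : T} (f : A ⟶ B) : (restrictedYoneda R).map f = 0 ↔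
    ∀ ⦃P : T⦄ (_ : R P) (x : P ⟶ A), x ≫ f = 0 := by
  constructor
  · intro h P hP x
    exact ConcreteCategory.congr_hom (NatTrans.congr_app h (.op ⟨P, hP⟩)) x
  · intro h
    ext P (x : P.unop.obj ⟶ A)
    exact h P.unop.property x

variable {R}

lemma restrictedYoneda_hom_app_apply {Q : T} (hQ : R Q)
    {M : R.FullSubcategoryᵒᵖ ⥤ AddCommGrpCat.{v}} (f : (restrictedYoneda R).obj Q ⟶ M)
    (P : R.FullSubcategoryᵒᵖ) (x : P.unop.obj ⟶ Q) :
    f.app P x = M.map (.op (ObjectProperty.homMk x)) (f.app (.op ⟨Q, hQ⟩) (𝟙 Q)) := by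
  have naturality := ConcreteCategory.congr_hom
    (f.naturality (X := .op ⟨Q, hQ⟩) (Y := P) (.op (ObjectProperty.homMk x))) (𝟙 Q)
  exact (congrArg (f.app P) (Category.comp_id x).symm).trans naturality

lemma restrictedYoneda_hom_ext {Q : T} (hQ : R Q) {M : R.FullSubcategoryᵒᵖ ⥤ AddCommGrpCat.{v}}
    {f g : (restrictedYoneda R).obj Q ⟶ M}
    (h : f.app (.op ⟨Q, hQ⟩) (𝟙 Q) = g.app (.op ⟨Q, hQ⟩) (𝟙 Q)) : f = g := by
  ext P x
  rw [restrictedYoneda_hom_app_apply hQ f P x, h, ← restrictedYoneda_hom_app_apply hQ g P x]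

lemma restrictedYoneda_map_bijective {Q : T} (hQ : R Q) (B : T) :
    Function.Bijective ((restrictedYoneda R).map :
      (Q ⟶ B) → ((restrictedYoneda R).obj Q ⟶ (restrictedYoneda R).obj B)) := by
  have app_id (f : Q ⟶ B) : ((restrictedYoneda R).map f).app (.op ⟨Q, hQ⟩) (𝟙 Q) = f :=
    Category.id_comp f
  refine ⟨fun f g h ↦ ?_, fun φ ↦ ⟨φ.app (.op ⟨Q, hQ⟩) (𝟙 Q), ?_⟩⟩
  · rw [← app_id f, ← app_id g, h]
  · exact restrictedYoneda_hom_ext hQ (app_id _)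

variable (R) in
/-- The functors isomorphic to the image of an object of `R` under the restricted Yoneda functor. -/
def representables : ObjectProperty (R.FullSubcategoryᵒᵖ ⥤ AddCommGrpCat.{v}) := fun X ↦
  ∃ Q : T, R Q ∧ Nonempty ((restrictedYoneda R).obj Q ≅ X)

lemma representables_obj {Q : T} (hQ : R Q) : representables R ((restrictedYoneda R).obj Q) :=
  ⟨Q, hQ, ⟨Iso.refl _⟩⟩

lemma isRelativelyProjective_representables : IsRelativelyProjective (representables R) := by
  rintro P P' Z c hc g ⟨Q, hQ, ⟨e⟩⟩ ⟨Q', -, ⟨e'⟩⟩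
  have : Epi ((e'.hom ≫ c).app (.op ⟨Q, hQ⟩)) := (NatTrans.epi_iff_epi_app _).1 inferInstance _
  obtain ⟨y, hy⟩ : ∃ y : Q ⟶ Q', (e'.hom ≫ c).app (.op ⟨Q, hQ⟩) y =
      (e.hom ≫ g).app (.op ⟨Q, hQ⟩) (𝟙 Q) := (AddCommGrpCat.epi_iff_surjective _).1 this _
  have hlift : (restrictedYoneda R).map y ≫ e'.hom ≫ c = e.hom ≫ g :=
    restrictedYoneda_hom_ext hQ <|
      (congrArg ((e'.hom ≫ c).app (.op ⟨Q, hQ⟩)) (Category.id_comp y)).trans hy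
  exact ⟨e.inv ≫ (restrictedYoneda R).map y ≫ e'.hom, by simp [hlift]⟩

lemma representables_biprod [HasBinaryBiproducts T] (hR : ∀ ⦃P Q : T⦄, R P → R Q → R (P ⊞ Q))
    ⦃X Y : R.FullSubcategoryᵒᵖ ⥤ AddCommGrpCat.{v}⦄ (hX : representables R X)
    (hY : representables R Y) : representables R (X ⊞ Y) := by
  obtain ⟨P, hP, ⟨e⟩⟩ := hX
  obtain ⟨Q, hQ, ⟨e'⟩⟩ := hY
  have := preservesBinaryBiproducts_of_preservesBiproducts (restrictedYoneda R)
  exact ⟨P ⊞ Q, hR hP hQ, ⟨(restrictedYoneda R).mapBiprod P Q ≪≫ biprod.mapIso e e'⟩⟩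

variable (R) in
/-- The category of coherent functors on `R`, that is, of the functors that are coherent with
respect to the representable ones. -/
abbrev CoherentFunctor := (IsCoherent (representables R)).FullSubcategory

instance : LocallySmall.{v} (CoherentFunctor R) where
  hom_small X Y := by
    obtain ⟨⟨P, p, ⟨Q, hQ, ⟨e⟩⟩, hp⟩, -⟩ := X.property
    refine small_of_injective (β := Y.obj.obj (.op ⟨Q, hQ⟩))
      (f := fun f ↦ (e.hom ≫ p ≫ f.hom).app (.op ⟨Q, hQ⟩) (𝟙 Q)) fun f g hfg ↦ ?_
    have h := restrictedYoneda_hom_ext hQ hfg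
    rw [cancel_epi, cancel_epi] at h
    exact ObjectProperty.hom_ext _ h

end RestrictedYoneda

/-! ### Coherent functors on a triangulated category -/

section CoherentFunctors

variable {T : Type u} [Category.{v} T] [Preadditive T]
  [HasZeroObject T] [HasShift T ℤ] [∀ n : ℤ, (shiftFunctor T n).Additive] [Pretriangulated T]
  {R : ObjectProperty T}

instance : (restrictedYoneda R).IsHomological where
  exact S hS := by
    refine (exact_map_restrictedYoneda_iff R _).2 fun P _ x hx ↦ ?_
    obtain ⟨y, hy⟩ := S.coyoneda_exact₂ hS x hx
    exact ⟨y, hy.symm⟩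

variable (R) in
/-- Every object `A` has a right approximation by an object `Q` of `R`: a morphism `Q ⟶ A` through
which all morphisms from objects of `R` to `A` factor. -/
def HasCovers : Prop :=
  ∀ A : T, ∃ (Q : T) (q : Q ⟶ A), R Q ∧ ∀ ⦃P : T⦄ (_ : R P) (x : P ⟶ A), ∃ y : P ⟶ Q, y ≫ q = x

lemma HasCovers.exists_exact (hR : HasCovers R) {P B : T} (g : P ⟶ B) :
    ∃ (Q : T) (q : Q ⟶ P) (w : q ≫ g = 0), R Q ∧
      ((ShortComplex.mk q g w).map (restrictedYoneda R)).Exact := by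
  obtain ⟨N, i, h, hT⟩ := distinguished_cocone_triangle₁ g
  obtain ⟨Q, q, hQ, hq⟩ := hR N
  have w : (q ≫ i) ≫ g = 0 := by
    rw [Category.assoc, show i ≫ g = 0 from comp_distTriang_mor_zero₁₂ _ hT, comp_zero]
  refine ⟨Q, q ≫ i, w, hQ, (exact_map_restrictedYoneda_iff R _).2 fun P' hP' x hx ↦ ?_⟩
  obtain ⟨y, hy⟩ := Triangle.coyoneda_exact₂ _ hT x hx
  obtain ⟨t, rfl⟩ := hq hP' y
  exact ⟨t, (hy.trans (Category.assoc t q i)).symm⟩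

lemma HasCovers.isCoherent_restrictedYoneda_obj (hR : HasCovers R) (B : T) :
    IsCoherent (representables R) ((restrictedYoneda R).obj B) := by
  refine ⟨?_, ?_⟩
  · obtain ⟨Q, q, hQ, hq⟩ := hR B
    exact ⟨_, (restrictedYoneda R).map q, representables_obj hQ,
      (epi_restrictedYoneda_map_iff R q).2 hq⟩
  · rintro P f ⟨P', hP', ⟨e⟩⟩
    obtain ⟨g, hg⟩ := (restrictedYoneda_map_bijective hP' B).2 (e.hom ≫ f)
    obtain ⟨Q, q, w, hQ, exact_q⟩ := hR.exists_exact g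
    have w' : ((restrictedYoneda R).map q ≫ e.hom) ≫ f = 0 := by
      rw [Category.assoc, ← hg, ← Functor.map_comp, w, Functor.map_zero]
    have i : (ShortComplex.mk _ _ w).map (restrictedYoneda R) ≅ ShortComplex.mk _ _ w' :=
      ShortComplex.isoMk (Iso.refl _) e (Iso.refl _) (Category.id_comp _)
        (hg.symm.trans (Category.comp_id _).symm)
    exact ⟨_, _, w', representables_obj hQ, ShortComplex.exact_of_iso i exact_q⟩

variable (R) in
/-- The conditions under which the coherent functors on `R` form an abelian category that contains
the functors represented by arbitrary objects of the ambient category. -/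
class IsCovering : Prop where
  hasCovers : HasCovers R
  biprod : ∀ ⦃P Q : T⦄, R P → R Q → R (P ⊞ Q)
  exists_isZero : ∃ Z : T, IsZero Z ∧ R Z

variable (R) [IsCovering R]

lemma exists_isZero_representables :
    ∃ Z : R.FullSubcategoryᵒᵖ ⥤ AddCommGrpCat.{v}, IsZero Z ∧ representables R Z := by
  obtain ⟨Z, hZ, hRZ⟩ := IsCovering.exists_isZero (R := R)
  exact ⟨_, (restrictedYoneda R).map_isZero hZ, representables_obj hRZ⟩

instance : (IsCoherent (representables R)).ContainsZero := by
  obtain ⟨Z, hZ, hZ'⟩ := exists_isZero_representables R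
  exact containsZero_isCoherent hZ hZ'

instance : (IsCoherent (representables R)).IsClosedUnderFiniteProducts := by
  obtain ⟨Z, hZ, hZ'⟩ := exists_isZero_representables R
  exact isClosedUnderFiniteProducts_isCoherent hZ hZ' (representables_biprod IsCovering.biprod)

instance : (IsCoherent (representables R)).IsClosedUnderCokernels :=
  isClosedUnderCokernels_isCoherent (representables_biprod IsCovering.biprod)
    isRelativelyProjective_representables

instance : (IsCoherent (representables R)).ι.PreservesHomology where
  preservesKernels _ _ f := ObjectProperty.preservesKernels_ι _ f
  preservesCokernels _ _ f := ObjectProperty.preservesCokernels_ι _ f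

/-- The restricted Yoneda functor with values in coherent functors. -/
def coherentYoneda : T ⥤ CoherentFunctor R :=
  ObjectProperty.lift _ (restrictedYoneda R) IsCovering.hasCovers.isCoherent_restrictedYoneda_obj

instance : (coherentYoneda R).PreservesZeroMorphisms where
  map_zero A B := ObjectProperty.hom_ext _ ((restrictedYoneda R).map_zero A B)

instance : (coherentYoneda R).IsHomological where
  exact S hS := (ShortComplex.exact_map_iff_of_faithful _ (IsCoherent (representables R)).ι).1
    ((restrictedYoneda R).map_distinguished_exact S hS)

lemma coherentYoneda_map_eq_zero_iff {A B : T} (f : A ⟶ B) : (coherentYoneda R).map f = 0 ↔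
    ∀ ⦃P : T⦄ (_ : R P) (x : P ⟶ A), x ≫ f = 0 := by
  rw [← restrictedYoneda_map_eq_zero_iff]
  exact ⟨fun h ↦ congrArg (fun φ ↦ φ.hom) h, fun h ↦ ObjectProperty.hom_ext _ h⟩

variable {R}

lemma isProjectiveLift_coherentYoneda {Q : T} (hQ : R Q) :
    IsProjectiveLift (coherentYoneda R) Q where
  projective := ⟨fun {Y Z} g c hc ↦ by
    have := (IsCoherent (representables R)).preservesEpimorphisms_ι_of_isNormalMonoCategory
    have : Epi c.hom := inferInstanceAs (Epi ((IsCoherent (representables R)).ι.map c))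
    obtain ⟨l, hl⟩ := isRelativelyProjective_representables.exists_lift
      (representables_obj hQ) Y.property c.hom g.hom
    exact ⟨ObjectProperty.homMk l, ObjectProperty.hom_ext _ hl⟩⟩
  bijective B := by
    obtain ⟨injective, surjective⟩ := restrictedYoneda_map_bijective hQ B
    refine ⟨fun f g h ↦ injective (congrArg (fun φ ↦ φ.hom) h), fun φ ↦ ?_⟩
    obtain ⟨f, hf⟩ := surjective φ.hom
    exact ⟨f, ObjectProperty.hom_ext _ hf⟩

variable (R) in
lemma hasEnoughProjectiveLifts_coherentYoneda :
    HasEnoughProjectiveLifts (coherentYoneda R) := fun X ↦ by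
  obtain ⟨⟨P, p, ⟨Q, hQ, ⟨e⟩⟩, hp⟩, -⟩ := X.property
  let c : (coherentYoneda R).obj Q ⟶ X := ObjectProperty.homMk (e.hom ≫ p)
  refine ⟨Q, c, isProjectiveLift_coherentYoneda hQ,
    (IsCoherent (representables R)).ι.epi_of_epi_map ?_⟩
  exact inferInstanceAs (Epi (e.hom ≫ p))

lemma exists_cokernel_iso (X : CoherentFunctor R) :
    ∃ f : Arrow T, Nonempty (cokernel ((coherentYoneda R).map f.hom) ≅ X) := by
  obtain ⟨P⟩ := (hasEnoughProjectiveLifts_coherentYoneda R).nonempty_liftedPresentation X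
  exact ⟨Arrow.mk P.a, ⟨(cokernelIsCokernel _).coconePointUniqueUpToIso P.exact.gIsCokernel⟩⟩

variable (R) in
/-- The universe levels are those of the test categories in the universal property. There is room
for such a model as a coherent functor is the cokernel of a morphism of `T`. -/
lemma exists_equivalence_coherentFunctor :
    ∃ (D : Type (max u v w)) (_ : Category.{max v z} D), Nonempty (D ≌ CoherentFunctor R) := by
  have : LocallySmall.{max v z} (CoherentFunctor R) :=
    ⟨fun X Y ↦ small_lift.{max u v, z, v} _⟩
  let obj : ULift.{max u v w} (Arrow T) → ShrinkHoms.{_} (CoherentFunctor R) := fun f ↦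
    ShrinkHoms.toShrinkHoms (cokernel ((coherentYoneda R).map f.down.hom))
  have : (inducedFunctor obj).EssSurj := ⟨fun X ↦ by
    obtain ⟨f, ⟨e⟩⟩ := exists_cokernel_iso (ShrinkHoms.fromShrinkHoms X)
    exact ⟨.up f, ⟨(ShrinkHoms.functor.{max v z} (CoherentFunctor R)).mapIso e⟩⟩⟩
  have : (inducedFunctor obj).IsEquivalence := {}
  exact ⟨InducedCategory _ obj, inferInstance, ⟨(inducedFunctor obj).asEquivalence.trans
    (ShrinkHoms.equivalence.{max v z} (CoherentFunctor R)).symm⟩⟩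

end CoherentFunctors

/-! ### Transport along equivalences of abelian categories -/

section Transport

/-- A category equivalent to an abelian category is abelian. -/
@[reducible]
noncomputable def abelianOfEquiv {D : Type u} [Category.{v} D] {E : Type u'} [Category.{v'} E]
    [Abelian E] (e : D ≌ E) : Abelian D :=
  letI := Preadditive.ofFullyFaithful e.fullyFaithfulFunctor
  haveI : HasFiniteProducts D := ⟨fun _ ↦ Adjunction.hasLimitsOfShape_of_equivalence e.functor⟩
  abelianOfEquivalence e.functor

/-- The stable structure carried over along an equivalence of abelian categories. -/
@[reducible]
noncomputable def stableCategoryOfEquiv {C : Type u} [Category.{v} C] [Abelian C]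
    [StableCategory C] {D : Type u'} [Category.{v'} D] [Abelian D] (e : C ≌ D) :
    StableCategory D where
  suspEquiv := e.symm.trans (StableCategory.suspEquiv.trans e)
  additive := by
    have : e.functor.Additive := Functor.additive_of_preserves_binary_products _
    have : e.inverse.Additive := Functor.additive_of_preserves_binary_products _
    exact inferInstanceAs (e.inverse ⋙ susp C ⋙ e.functor).Additive

variable {T : Type u} [Category.{v} T] [Preadditive T]
  [HasZeroObject T] [HasShift T ℤ] [∀ n : ℤ, (shiftFunctor T n).Additive] [Pretriangulated T]
  {C : Type u'} [Category.{v'} C] [Abelian C] [StableCategory C]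
  {D : Type u''} [Category.{v''} D] [Abelian D] [StableCategory D]

/-- The composition of a stable homological functor with a stable exact functor. -/
noncomputable def StableHomologicalFunctor.comp (F : StableHomologicalFunctor T C)
    (H : StableExactFunctor C D) : StableHomologicalFunctor T D where
  functor := F.functor ⋙ H.functor
  isHomological := { exact := fun S hS ↦ (F.functor.map_distinguished_exact S hS).map H.functor }
  suspIso := Functor.isoWhiskerRight F.suspIso H.functor ≪≫
    Functor.isoWhiskerLeft F.functor H.suspIso

/-- The tautological factorization of a composition, by which a stable exact functor is an instance
of the universal property. -/
noncomputable def StableFactorization.ofComp (F : StableHomologicalFunctor T C)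
    (H : StableExactFunctor C D) : StableFactorization F (F.comp H) where
  lift := H
  iso := Iso.refl _
  iso_susp A := by simp [StableHomologicalFunctor.comp]

/-- The composition of stable exact functors. -/
def StableExactFunctor.comp {E : Type w} [Category.{z} E] [Abelian E] [StableCategory E]
    (H : StableExactFunctor C D) (K : StableExactFunctor D E) : StableExactFunctor C E where
  functor := H.functor ⋙ K.functor
  preservesFiniteLimits := inferInstance
  preservesFiniteColimits := inferInstance
  suspIso := Functor.isoWhiskerRight H.suspIso K.functor ≪≫
    Functor.isoWhiskerLeft H.functor K.suspIso

/-- The composition of factorizations. -/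
def StableFactorization.comp {E : Type w} [Category.{z} E] [Abelian E] [StableCategory E]
    {F : StableHomologicalFunctor T C} {G : StableHomologicalFunctor T D}
    {K : StableHomologicalFunctor T E} (Φ : StableFactorization F G)
    (Ψ : StableFactorization G K) : StableFactorization F K where
  lift := Φ.lift.comp Ψ.lift
  iso := Functor.isoWhiskerRight Φ.iso Ψ.lift.functor ≪≫ Ψ.iso
  iso_susp A := by
    have h₁ := Ψ.lift.functor.congr_map (Φ.iso_susp A)
    have h₂ := Ψ.iso_susp A
    have h₃ := Ψ.lift.suspIso.hom.naturality (Φ.iso.hom.app A)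
    dsimp [StableExactFunctor.comp] at h₁ h₂ h₃ ⊢
    simp only [Functor.map_comp, Category.assoc] at h₁ h₂ ⊢
    rw [h₂, reassoc_of% h₁, reassoc_of% h₃]

lemma StableFactorization.map_eq_zero {F : StableHomologicalFunctor T C}
    {G : StableHomologicalFunctor T D} (Φ : StableFactorization F G) {A B : T} {f : A ⟶ B}
    (hf : F.functor.map f = 0) : G.functor.map f = 0 := by
  rw [← NatIso.naturality_1 Φ.iso f, Functor.comp_map, hf, Functor.map_zero, zero_comp, comp_zero]

variable (C) in
lemma exists_stableExactFunctor_isEquivalence :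
    ∃ (D : Type (max u' w)) (_ : Category.{max v' z} D) (_ : Abelian D) (_ : StableCategory D)
      (H : StableExactFunctor C D), H.functor.IsEquivalence := by
  obtain ⟨D, _, ⟨e⟩⟩ : ∃ (D : Type (max u' w)) (_ : Category.{max v' z} D), Nonempty (C ≌ D) :=
    ⟨_, _, ⟨ULiftHomULiftCategory.equiv.{z, w} C⟩⟩
  let : Abelian D := abelianOfEquiv e.symm
  let : StableCategory D := stableCategoryOfEquiv e
  exact ⟨D, inferInstance, inferInstance, inferInstance,
    ⟨e.functor, inferInstance, inferInstance,
      Functor.isoWhiskerRight e.unitIso (susp C ⋙ e.functor)⟩, e.isEquivalence_functor⟩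

end Transport

/-! ### Homological ideals with enough projective objects -/

section Ideals

variable {T : Type u} [Category.{v} T] [Preadditive T] {I : MorphismIdeal T}

namespace MorphismIdeal

lemma isProjective_iff {P : T} : I.IsProjective P ↔
    ∀ ⦃A B : T⦄ (f : A ⟶ B), f ∈ I.hom A B → ∀ x : P ⟶ A, x ≫ f = 0 := by
  refine forall₄_congr fun A B f _ ↦ ⟨fun h x ↦ ConcreteCategory.congr_hom h x, fun h ↦ ?_⟩
  ext x
  exact h x

lemma comp_mem_left {A B X : T} {f : A ⟶ B} (hf : f ∈ I.hom A B) (g : B ⟶ X) :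
    f ≫ g ∈ I.hom A X := by
  simpa only [Category.id_comp] using I.comp_mem (𝟙 A) f g hf

end MorphismIdeal

variable [HasZeroObject T] [HasShift T ℤ] [∀ n : ℤ, (shiftFunctor T n).Additive]
  [Pretriangulated T]

namespace MorphismIdeal

lemma HasEnoughProjectives.isCovering (hI : I.HasEnoughProjectives) :
    IsCovering (T := T) I.IsProjective where
  hasCovers A := by
    obtain ⟨P, π, hP, X, g, h, hT, hg⟩ := hI A
    refine ⟨P, π, hP, fun P' hP' x ↦ ?_⟩
    obtain ⟨y, hy⟩ := Triangle.coyoneda_exact₂ _ hT x (isProjective_iff.1 hP' g hg x)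
    exact ⟨y, hy.symm⟩
  biprod P Q hP hQ := isProjective_iff.2 fun A B f hf x ↦ by
    ext
    · simpa using isProjective_iff.1 hP f hf (biprod.inl ≫ x)
    · simpa using isProjective_iff.1 hQ f hf (biprod.inr ≫ x)
  exists_isZero := by
    obtain ⟨Z, hZ⟩ := HasZeroObject.zero (C := T)
    exact ⟨Z, hZ, isProjective_iff.2 fun _ _ _ _ _ ↦ hZ.eq_of_src _ _⟩

lemma HasEnoughProjectives.mem_iff (hI : I.HasEnoughProjectives) {A B : T} (f : A ⟶ B) :
    f ∈ I.hom A B ↔ ∀ ⦃P : T⦄ (_ : I.IsProjective P) (x : P ⟶ A), x ≫ f = 0 := by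
  refine ⟨fun hf P hP ↦ isProjective_iff.1 hP f hf, fun h ↦ ?_⟩
  obtain ⟨P, π, hP, X, g, h', hT, hg⟩ := hI A
  obtain ⟨k, rfl⟩ := Triangle.yoneda_exact₂ _ hT f (h hP π)
  exact comp_mem_left hg k

lemma map_shift_eq_zero_iff {D : Type u'} [Category.{v'} D] [Abelian D] [StableCategory D]
    (G : StableHomologicalFunctor T D) {A B : T} (f : A ⟶ B) :
    G.functor.map (f⟦(1 : ℤ)⟧') = 0 ↔ G.functor.map f = 0 := by
  let σ (Z : T) : G.functor.obj (Z⟦(1 : ℤ)⟧) ≅ (susp D).obj (G.functor.obj Z) := G.suspIso.app Z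
  have h : G.functor.map (f⟦(1 : ℤ)⟧') ≫ (σ B).hom = (σ A).hom ≫ (susp D).map (G.functor.map f) :=
    G.suspIso.hom.naturality f
  rw [← (susp D).map_eq_zero_iff (f := G.functor.map f)]
  constructor
  · intro hf
    rw [← cancel_epi (σ A).hom, ← h, hf, zero_comp, comp_zero]
  · intro hf
    rw [← cancel_mono (σ B).hom, h, hf, zero_comp, comp_zero]

lemma IsHomological.shift_mem_iff (hI : IsHomological.{u, v, u'', v''} I) {A B : T} (f : A ⟶ B) :
    f⟦(1 : ℤ)⟧' ∈ I.hom _ _ ↔ f ∈ I.hom A B := by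
  obtain ⟨D, _, _, _, G, rfl⟩ := hI
  exact map_shift_eq_zero_iff G f

lemma IsHomological.shift_neg_mem (hI : IsHomological.{u, v, u'', v''} I) {A B : T} {f : A ⟶ B}
    (hf : f ∈ I.hom A B) : f⟦(-1 : ℤ)⟧' ∈ I.hom _ _ := by
  rw [← hI.shift_mem_iff]
  have conj := NatIso.naturality_2 (shiftEquiv T (1 : ℤ)).counitIso f
  exact conj ▸ I.comp_mem _ f _ hf

end MorphismIdeal

instance isHomological_shift_comp {C : Type u'} [Category.{v'} C]
    [Abelian C] (F : T ⥤ C) [F.IsHomological] (n : ℤ) : (shiftFunctor T n ⋙ F).IsHomological where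
  exact S hS :=
    letI := Functor.ShiftSequence.tautological F ℤ
    F.homologySequence_exact₂ S hS n

/-- The suspension of the target and its inverse are the extensions of `F ∘ Σ` and `F ∘ Σ⁻¹`
along `F`. -/
lemma HasEnoughProjectiveLifts.exists_stableHomologicalFunctor {D : Type u'} [Category.{v'} D]
    [Abelian D] {F : T ⥤ D} [F.IsHomological] (hF : HasEnoughProjectiveLifts F)
    (shift : ∀ ⦃A B : T⦄ (f : A ⟶ B), F.map f = 0 → F.map (f⟦(1 : ℤ)⟧') = 0)
    (shift_neg : ∀ ⦃A B : T⦄ (f : A ⟶ B), F.map f = 0 → F.map (f⟦(-1 : ℤ)⟧') = 0) :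
    ∃ (_ : StableCategory D) (F' : StableHomologicalFunctor T D), F'.functor = F := by
  obtain ⟨S, _, _, ⟨σ⟩⟩ :=
    (hF.isRelExact (G := shiftFunctor T (1 : ℤ) ⋙ F) shift).exists_exact_extension hF
  obtain ⟨S', _, _, ⟨σ'⟩⟩ :=
    (hF.isRelExact (G := shiftFunctor T (-1 : ℤ) ⋙ F) shift_neg).exists_exact_extension hF
  have : S.PreservesZeroMorphisms := Functor.preservesZeroMorphisms_of_preserves_initial_object
  have : S'.PreservesZeroMorphisms := Functor.preservesZeroMorphisms_of_preserves_initial_object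
  obtain ⟨unitIso, -⟩ := hF.exists_iso (H := S ⋙ S') (K := 𝟭 D) <|
    Functor.isoWhiskerRight σ S' ≪≫ Functor.isoWhiskerLeft (shiftFunctor T (1 : ℤ)) σ' ≪≫
      Functor.isoWhiskerRight (shiftEquiv T (1 : ℤ)).unitIso.symm F
  obtain ⟨counitIso, -⟩ := hF.exists_iso (H := S' ⋙ S) (K := 𝟭 D) <|
    Functor.isoWhiskerRight σ' S ≪≫ Functor.isoWhiskerLeft (shiftFunctor T (-1 : ℤ)) σ ≪≫
      Functor.isoWhiskerRight (shiftEquiv T (1 : ℤ)).counitIso F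
  let stable : StableCategory D :=
    ⟨CategoryTheory.Equivalence.mk S S' unitIso.symm counitIso,
      show S.Additive from Functor.additive_of_preserves_binary_products S⟩
  exact ⟨stable, ⟨F, inferInstance, σ.symm⟩, rfl⟩

lemma MorphismIdeal.HasEnoughProjectives.exists_homologicalFunctor (hI : I.HasEnoughProjectives) :
    ∃ (D : Type (max u v w)) (_ : Category.{max v z} D) (_ : Abelian D) (F : T ⥤ D)
      (_ : F.IsHomological), HasEnoughProjectiveLifts F ∧
        ∀ ⦃A B : T⦄ (f : A ⟶ B), F.map f = 0 ↔ f ∈ I.hom A B := by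
  have := hI.isCovering
  obtain ⟨D, _, ⟨e⟩⟩ := exists_equivalence_coherentFunctor.{w, z} (T := T) I.IsProjective
  let : Abelian D := abelianOfEquiv e
  have : e.inverse.PreservesZeroMorphisms :=
    Functor.preservesZeroMorphisms_of_preserves_initial_object
  let Y := coherentYoneda (T := T) I.IsProjective
  refine ⟨D, inferInstance, inferInstance, Y ⋙ e.inverse,
    { exact := fun S hS ↦ (Y.map_distinguished_exact S hS).map e.inverse },
    (hasEnoughProjectiveLifts_coherentYoneda _).comp_isEquivalence _, fun A B f ↦ ?_⟩
  rw [hI.mem_iff, ← coherentYoneda_map_eq_zero_iff]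
  exact e.inverse.map_eq_zero_iff

lemma MorphismIdeal.HasEnoughProjectives.exists_stableHomologicalFunctor
    (hI : I.HasEnoughProjectives) (hI' : IsHomological.{u, v, u'', v''} I) :
    ∃ (D : Type (max u v w)) (_ : Category.{max v z} D) (_ : Abelian D) (_ : StableCategory D)
      (F : StableHomologicalFunctor T D),
      kerStable F = I ∧ HasEnoughProjectiveLifts F.functor := by
  obtain ⟨D, _, _, F, _, hF, map_eq_zero_iff⟩ := hI.exists_homologicalFunctor.{w, z}
  obtain ⟨_, F', rfl⟩ := hF.exists_stableHomologicalFunctor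
    (fun A B f hf ↦ by simpa only [map_eq_zero_iff, hI'.shift_mem_iff] using hf)
    (fun A B f hf ↦ (map_eq_zero_iff _).2 (hI'.shift_neg_mem ((map_eq_zero_iff f).1 hf)))
  refine ⟨D, inferInstance, inferInstance, inferInstance, F', ?_, hF⟩
  ext A B f
  rw [mem_kerStable_iff, map_eq_zero_iff]

end Ideals

/-! ### The universal property -/

section Universal

variable {T : Type u} [Category.{v} T] [Preadditive T]
  [HasZeroObject T] [HasShift T ℤ] [∀ n : ℤ, (shiftFunctor T n).Additive] [Pretriangulated T]
  {C : Type u'} [Category.{v'} C] [Abelian C] [StableCategory C]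
  {I : MorphismIdeal T} {F : StableHomologicalFunctor T C}

/-- `C` itself may live in too small a universe to be a test category, so uniqueness is applied to
the composition of `F` with an equivalence onto a larger copy of `C`. -/
lemma IsUniversalExact.nonempty_iso_id (hF : IsUniversalExact.{max u' w, max v' z} I F)
    (Ω : StableFactorization F F) : Nonempty (𝟭 C ≅ Ω.lift.functor) := by
  obtain ⟨C', _, _, _, H, _⟩ := exists_stableExactFunctor_isEquivalence.{w, z} C
  let Υ := StableFactorization.ofComp F H
  obtain ⟨θ, -⟩ := hF.unique C' (F.comp H)
    (fun _ _ f hf ↦ Υ.map_eq_zero (hF.isExact f hf)) Υ (Ω.comp Υ)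
  exact ⟨Functor.fullyFaithfulCancelRight H.functor θ⟩

lemma IsUniversalExact.kerStable_eq_and_hasEnoughProjectiveLifts
    (hI : MorphismIdeal.IsHomological.{u, v, u'', v''} I)
    (hF : IsUniversalExact.{max u v u' w, max v v' z} I F) (h : I.HasEnoughProjectives) :
    MorphismIdeal.kerStable F = I ∧ HasEnoughProjectiveLifts F.functor := by
  obtain ⟨D, _, _, _, U, rfl, hU⟩ := h.exists_stableHomologicalFunctor.{max u' w, max v' z} hI
  obtain ⟨Φ⟩ := hF.exists_factorization D U fun _ _ _ hf ↦ hf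
  obtain ⟨Ψ⟩ := hU.nonempty_stableFactorization hF.isExact
  obtain ⟨unitIso⟩ := hF.nonempty_iso_id.{max u v w, max v z} (Φ.comp Ψ)
  obtain ⟨counitIso, -⟩ := hU.exists_iso (H := Ψ.lift.functor ⋙ Φ.lift.functor) (K := 𝟭 D)
    (Functor.isoWhiskerRight Ψ.iso Φ.lift.functor ≪≫ Φ.iso)
  have : Ψ.lift.functor.IsEquivalence :=
    (CategoryTheory.Equivalence.mk Ψ.lift.functor Φ.lift.functor
      counitIso.symm unitIso.symm).isEquivalence_functor
  refine ⟨?_, (hU.comp_isEquivalence Ψ.lift.functor).of_iso Ψ.iso⟩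
  ext A B f
  exact ⟨fun hf ↦ Φ.map_eq_zero hf, hF.isExact f⟩

end Universal

theorem theorem3_general {T : Type u} [Category.{v} T] [Preadditive T] [HasZeroObject T]
    [HasShift T ℤ] [∀ n : ℤ, (shiftFunctor T n).Additive] [Pretriangulated T]
    [IsIdempotentComplete T]
    {C : Type u'} [Category.{v'} C] [Abelian C] [StableCategory C]
    (I : MorphismIdeal T) (hI : MorphismIdeal.IsHomological.{u, v, u'', v''} I)
    (F : StableHomologicalFunctor T C) :
    (IsUniversalExact.{max u v u' w, max v v' z} I F ∧ I.HasEnoughProjectives) ↔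
      (MorphismIdeal.kerStable F = I ∧
        EnoughProjectives C ∧
        ∃ h : isProjective C ≤ F.functor.leftAdjointObjIsDefined,
          Nonempty (ObjectProperty.ιOfLE h ⋙ F.functor.partialLeftAdjoint ⋙ F.functor ≅
            (isProjective C).ι)) := by
  rw [← projectivesLift_iff]
  constructor
  · rintro ⟨universal, enough⟩
    obtain ⟨ker_eq, hF⟩ := universal.kerStable_eq_and_hasEnoughProjectiveLifts hI enough
    exact ⟨ker_eq, hF.enoughProjectives, hF.projectivesLift⟩
  · rintro ⟨rfl, _, lift⟩
    have hF := lift.hasEnoughProjectiveLifts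
    exact ⟨hF.isUniversalExact, hF.hasEnoughProjectives_kerStable⟩

theorem theorem3 {T : Type u} [Category.{v} T] [Preadditive T] [HasZeroObject T]
    [HasShift T ℤ] [∀ n : ℤ, (shiftFunctor T n).Additive] [Pretriangulated T] [IsTriangulated T]
    [IsIdempotentComplete T]
    {C : Type u'} [Category.{v'} C] [Abelian C] [StableCategory C]
    (I : MorphismIdeal T) (hI : MorphismIdeal.IsHomological.{u, v, u'', v''} I)
    (F : StableHomologicalFunctor T C) (hF : I.IsExact F.functor) :
    (IsUniversalExact.{max u v u' w, max v v' z} I F ∧ I.HasEnoughProjectives) ↔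
      (MorphismIdeal.kerStable F = I ∧
        EnoughProjectives C ∧
        ∃ h : isProjective C ≤ F.functor.leftAdjointObjIsDefined,
          Nonempty (ObjectProperty.ιOfLE h ⋙ F.functor.partialLeftAdjoint ⋙ F.functor ≅
            (isProjective C).ι)) :=
  theorem3_general I hI F
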